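/- All graphs are finite, undirected, without loops or parallel edges. A graph is claw-free if it has no induced subgraph isomorphic to $K_{1,3}$; it is 3-connected if it has more than three vertices and remains connected after the deletion of any set of at most two vertices. A $\Lambda$-factor of a graph $H$ is a spanning subgraph of $H$ every component of which is a 3-vertex path. For a subgraph $L$ of $G$, $G-L$ denotes the graph obtained from $G$ by deleting all vertices of $L$. Let $G$ be a 3-connected claw-free graph whose number of vertices satisfies $v(G)\equiv 0 \pmod 3$, and let $xy\in E(G)$. Then there exist at least two distinct 3-vertex paths $L_1$ and $L_2$ in $G$, each having $y$ as its middle vertex and containing the edge $xy$, such that for each $i\in\{1,2\}$ the graph $G-L_i$ is connected and has a $\Lambda$-factor. -/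

import Mathlib

namespace LambdaPacking

/-- `G` is `k`-connected: it has more than `k` vertices, and deleting any set of fewer than `k`
vertices leaves a connected graph. -/
def IsVertexConnected {V : Type*} (G : SimpleGraph V) (k : ℕ) : Prop :=
  k < Nat.card V ∧ ∀ S : Finset V, S.card < k → (G.induce ((S : Set V)ᶜ)).Connected

/-- `G` is claw-free: it has no induced subgraph isomorphic to `K_{1,3}`. -/
def IsClawFree {V : Type*} (G : SimpleGraph V) : Prop :=
  ¬ (completeBipartiteGraph (Fin 1) (Fin 3)).IsIndContained G

/-- An `H`-packing of `G`: a subgraph of `G` every component of which is isomorphic to `H`. -/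
def IsPacking {V W : Type*} (H : SimpleGraph W) {G : SimpleGraph V} (P : G.Subgraph) : Prop :=
  ∀ c : P.coe.ConnectedComponent, Nonempty (c.toSimpleGraph ≃g H)

/-- An `H`-factor of `G`: an `H`-packing of `G` that contains every vertex of `G`. -/
def IsFactor {V W : Type*} (H : SimpleGraph W) {G : SimpleGraph V} (P : G.Subgraph) : Prop :=
  IsPacking H P ∧ P.IsSpanning

/-- `G` has a `Λ`-factor, where `Λ` is the 3-vertex path. -/
def HasLambdaFactor {V : Type*} (G : SimpleGraph V) : Prop :=
  ∃ P : G.Subgraph, IsFactor (SimpleGraph.pathGraph 3) P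

/-- The subgraph `L` of `G` is a 3-vertex path whose middle vertex is `y`. -/
def IsLambdaCenteredAt {V : Type*} {G : SimpleGraph V} (L : G.Subgraph) (y : V) : Prop :=
  ∃ e : SimpleGraph.pathGraph 3 ≃g L.coe, (e 1 : V) = y

/-- `G - L`: the graph obtained from `G` by deleting all vertices of the subgraph `L`. -/
def minus {V : Type*} (G : SimpleGraph V) (L : G.Subgraph) :
    SimpleGraph ((L.verts)ᶜ : Set V) :=
  G.induce ((L.verts)ᶜ)

end LambdaPacking

namespace LambdaPacking

set_option linter.unusedSectionVars false

/-! ### Vertex sets: connectivity, separation, lobes and end-blocks. -/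

variable {V : Type*} [DecidableEq V] {G : SimpleGraph V}

/-! Delete `x` and `y` and let `S` be the remaining vertex set, connected by 3-connectivity. It
suffices to find two neighbours `z` of `y` in `S` for which `S - z` is `Good`, that is, connected
with at most two end-blocks: by `Good.fac`, a claw-free good set of size divisible by 3 has a
Λ-factor.

End-blocks are handled through lobes: a lobe at `e` is a union of some, but not all, components of
`S - e`, and goodness forbids three pairwise apart lobes. Claw-freeness says that no vertex sees
three pairwise apart sets (`NoClaw.not_sees`). Almost every contradiction below is either such a
claw or a triple of apart lobes in a good set.

Choice of `z` (`EdgeDeleted.exists_two_good`). If `S` has no cut vertex, every `S - z` is good by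
claw-freeness at `z`, and `y` has two neighbours in `S`. Otherwise two leaves on opposite sides of a
cut vertex each supply one `z`: if a neighbour `z` of `y` in the leaf is bad, the way `x`, `y`, `z`
see three apart lobes of `S - z` is forced, and a neighbour of `y` in one of these lobes must then
be good.

`Good.fac` is an induction on size that divides `S` into smaller good sets of size divisible by 3.
At a cut vertex, or a cut of two or three vertices, residues mod 3 decide which side receives which
cut vertices. The hard case (`Split.fac`) is a cut vertex `c` both of whose sides `C`, `D` have size
1 mod 3: one moves a neighbour `w` of `c` from `D` to `C + c`. If `D - w` is bad, it is cut again at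
the boundary of a largest suitable lobe `X` (`Arm`), and each residue of `|X|` allows a partition.
When no such cut is present, a path on three vertices is removed and the rest is good. -/

/-- No vertex has three pairwise non-adjacent neighbours. -/
def NoClaw (G : SimpleGraph V) : Prop :=
  ∀ c a₁ a₂ a₃, G.Adj c a₁ → G.Adj c a₂ → G.Adj c a₃ → a₁ ≠ a₂ → a₁ ≠ a₃ → a₂ ≠ a₃ →
    G.Adj a₁ a₂ ∨ G.Adj a₁ a₃ ∨ G.Adj a₂ a₃

/-- `S` induces a connected subgraph, in terms of sets closed under adjacency. -/
def Conn (G : SimpleGraph V) (S : Finset V) : Prop :=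
  S.Nonempty ∧ ∀ A ⊆ S, A.Nonempty → (∀ a ∈ A, ∀ b ∈ S, G.Adj a b → b ∈ A) → A = S

/-- `A` and `B` are disjoint and no edge joins them. -/
def Apart (G : SimpleGraph V) (A B : Finset V) : Prop :=
  ∀ a ∈ A, ∀ b ∈ B, a ≠ b ∧ ¬ G.Adj a b

/-- `v` has a neighbour in `A`. -/
def Sees (G : SimpleGraph V) (v : V) (A : Finset V) : Prop :=
  ∃ a ∈ A, G.Adj v a

/-- Inside `S`, the vertex `e` separates the nonempty set `E` from some other vertex. -/
structure Lobe (G : SimpleGraph V) (S E : Finset V) (e : V) : Prop where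
  subset : E ⊆ S
  nonempty : E.Nonempty
  mem : e ∈ S
  notMem : e ∉ E
  boundary : ∀ a ∈ E, ∀ b ∈ S, G.Adj a b → b ∈ E ∨ b = e
  rest : ∃ r ∈ S, r ∉ E ∧ r ≠ e

/-- An inclusion-minimal lobe. -/
structure Leaf (G : SimpleGraph V) (S E : Finset V) (e : V) : Prop extends Lobe G S E e where
  minimal : ∀ E' e', Lobe G S E' e' → E' ⊆ E → E' = E

/-- `S` is connected and has no three pairwise separated lobes, that is, it has at most two
end-blocks. -/
def Good (G : SimpleGraph V) (S : Finset V) : Prop :=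
  Conn G S ∧ ∀ E₁ e₁ E₂ e₂ E₃ e₃, Lobe G S E₁ e₁ → Lobe G S E₂ e₂ → Lobe G S E₃ e₃ →
    Apart G E₁ E₂ → Apart G E₁ E₃ → Apart G E₂ E₃ → False

/-- Deleting `c` splits `S` into exactly the two components `C` and `D`. -/
structure Split (G : SimpleGraph V) (S : Finset V) (c : V) (C D : Finset V) : Prop where
  eq : S = insert c (C ∪ D)
  notMem_left : c ∉ C
  notMem_right : c ∉ D
  apart : Apart G C D
  conn_left : Conn G C
  conn_right : Conn G D
  sees_left : Sees G c C
  sees_right : Sees G c D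

lemma Apart.symm {A B : Finset V} (h : Apart G A B) : Apart G B A :=
  fun a ha b hb => ⟨fun e => (h b hb a ha).1 e.symm, fun e => (h b hb a ha).2 e.symm⟩

lemma Apart.mono {A B A' B' : Finset V} (h : Apart G A B) (hA : A' ⊆ A) (hB : B' ⊆ B) :
    Apart G A' B' :=
  fun a ha b hb => h a (hA ha) b (hB hb)

lemma Sees.mono {v : V} {A B : Finset V} (h : Sees G v A) (hA : A ⊆ B) : Sees G v B := by
  obtain ⟨a, ha, hv⟩ := h
  exact ⟨a, hA ha, hv⟩

lemma Split.symm {S C D : Finset V} {c : V} (h : Split G S c C D) : Split G S c D C :=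
  ⟨by rw [h.eq, Finset.union_comm], h.notMem_right, h.notMem_left, h.apart.symm, h.conn_right,
    h.conn_left, h.sees_right, h.sees_left⟩

lemma NoClaw.not_sees (hG : NoClaw G) {v : V} {A B C : Finset V} (hA : Sees G v A)
    (hB : Sees G v B) (hC : Sees G v C) (hAB : Apart G A B) (hAC : Apart G A C)
    (hBC : Apart G B C) : False := by
  obtain ⟨a, ha, hva⟩ := hA
  obtain ⟨b, hb, hvb⟩ := hB
  obtain ⟨c, hc, hvc⟩ := hC
  have h₁ := hAB a ha b hb
  have h₂ := hAC a ha c hc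
  have h₃ := hBC b hb c hc
  rcases hG v a b c hva hvb hvc h₁.1 h₂.1 h₃.1 with h | h | h
  · exact h₁.2 h
  · exact h₂.2 h
  · exact h₃.2 h

lemma conn_singleton (v : V) : Conn G {v} := by
  refine ⟨Finset.singleton_nonempty v, fun A hA hne _ => ?_⟩
  exact (Finset.Nonempty.subset_singleton_iff hne).1 hA

lemma Conn.exists_adj {S A : Finset V} (hS : Conn G S) (hA : A ⊆ S) (hne : A.Nonempty)
    (hprop : ∃ r ∈ S, r ∉ A) : ∃ a ∈ A, ∃ b ∈ S, b ∉ A ∧ G.Adj a b := by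
  by_contra! h
  obtain ⟨r, hr, hrA⟩ := hprop
  have := hS.2 A hA hne (fun a ha b hb hab => by
    by_contra hbA
    exact h a ha b hb hbA hab)
  exact hrA (this ▸ hr)

lemma Conn.subset_of_closed {S B : Finset V} (hS : Conn G S) (hne : ∃ a ∈ S, a ∈ B)
    (hcl : ∀ a ∈ S, a ∈ B → ∀ b ∈ S, G.Adj a b → b ∈ B) : S ⊆ B := by
  obtain ⟨a, ha, haB⟩ := hne
  have := hS.2 (S ∩ B) Finset.inter_subset_left ⟨a, by simp [ha, haB]⟩ (by
    intro a ha b hb hab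
    simp only [Finset.mem_inter] at ha ⊢
    exact ⟨hb, hcl a ha.1 ha.2 b hb hab⟩)
  exact Finset.inter_eq_left.1 this

lemma Conn.union {A B : Finset V} (hA : Conn G A) (hB : Conn G B)
    (h : ∃ a ∈ A, ∃ b ∈ B, G.Adj a b) : Conn G (A ∪ B) := by
  obtain ⟨a, ha, b, hb, hab⟩ := h
  refine ⟨⟨a, by simp [ha]⟩, fun D hD hne hcl => ?_⟩
  have key : A ⊆ D ∨ B ⊆ D := by
    obtain ⟨d, hd⟩ := hne
    rcases Finset.mem_union.1 (hD hd) with h | h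
    · left
      exact hA.subset_of_closed (B := D) ⟨d, h, hd⟩ (fun a _ haD b hb hab =>
        hcl a haD b (by simp [hb]) hab)
    · right
      exact hB.subset_of_closed (B := D) ⟨d, h, hd⟩ (fun a _ haD b hb hab =>
        hcl a haD b (by simp [hb]) hab)
  have key2 : a ∈ D ∧ b ∈ D := by
    rcases key with h | h
    · exact ⟨h ha, hcl a (h ha) b (by simp [hb]) hab⟩
    · exact ⟨hcl b (h hb) a (by simp [ha]) hab.symm, h hb⟩
  have h1 : A ⊆ D := hA.subset_of_closed (B := D) ⟨a, ha, key2.1⟩ (fun a _ haD b hb hab =>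
        hcl a haD b (by simp [hb]) hab)
  have h2 : B ⊆ D := hB.subset_of_closed (B := D) ⟨b, hb, key2.2⟩ (fun a _ haD b hb hab =>
        hcl a haD b (by simp [hb]) hab)
  exact Finset.Subset.antisymm hD (Finset.union_subset h1 h2)

lemma Conn.insert {A : Finset V} {v : V} (hA : Conn G A) (h : Sees G v A) :
    Conn G (insert v A) := by
  obtain ⟨a, ha, hva⟩ := h
  exact (conn_singleton v).union hA ⟨v, by simp, a, ha, hva⟩

/-- A proper closed part of `S` exists when `S` is not connected. -/
lemma exists_closed_of_not_conn {S : Finset V} (hne : S.Nonempty) (hS : ¬ Conn G S) :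
    ∃ A ⊆ S, A.Nonempty ∧ (∃ r ∈ S, r ∉ A) ∧ ∀ a ∈ A, ∀ b ∈ S, G.Adj a b → b ∈ A := by
  by_contra! h
  refine hS ⟨hne, fun A hA hAne hcl => Finset.Subset.antisymm hA fun r hr => ?_⟩
  by_contra hrA
  obtain ⟨a, ha, b, hb, hab, hbA⟩ := h A hA hAne ⟨r, hr, hrA⟩
  exact hbA (hcl a ha b hb hab)

lemma Lobe.compl {S X : Finset V} {f : V} (h : Lobe G S X f) :
    Lobe G S ((S \ X).erase f) f := by
  obtain ⟨hsub, ⟨x, hx⟩, hm, hnm, hb, r, hr, hrX, hrf⟩ := h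
  refine ⟨fun a => by grind, ⟨r, by grind⟩, hm, by grind, fun a ha b hbS hab => ?_, x, ?_⟩
  · have := fun hbX : b ∈ X => hb b hbX a (by grind) hab.symm
    grind
  · grind

lemma Lobe.sees {S X : Finset V} {f : V} (hS : Conn G S) (h : Lobe G S X f) : Sees G f X := by
  obtain ⟨r, hr, hrX, hrf⟩ := h.rest
  obtain ⟨a, ha, b, hb, hbX, hab⟩ := hS.exists_adj h.subset h.nonempty ⟨r, hr, hrX⟩
  have := h.boundary a ha b hb hab
  rcases this with h | rfl
  · exact absurd h hbX
  · exact ⟨a, ha, hab.symm⟩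

lemma Lobe.apart_compl {S X : Finset V} {f : V} (h : Lobe G S X f) :
    Apart G X ((S \ X).erase f) := by
  intro a ha b hb
  have := h.boundary a ha b
  grind

/-- If `X` fell into two closed parts, `f` would see both of them and also the rest of `S`, giving a
claw. Hence in a claw-free set a cut vertex leaves exactly two components. -/
lemma Lobe.conn (hG : NoClaw G) {S X : Finset V} {f : V} (hS : Conn G S) (h : Lobe G S X f) :
    Conn G X := by
  by_contra hX
  obtain ⟨A, hA, hAne, ⟨r, hr, hrA⟩, hcl⟩ := exists_closed_of_not_conn h.nonempty hX
  have hb := h.boundary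
  have hs := h.subset
  have hnm := h.notMem
  obtain ⟨q, hq⟩ := h.rest
  have h1 : Lobe G S A f := ⟨hA.trans h.subset, hAne, h.mem, fun h' => hnm (hA h'),
    fun a ha b hbS hab => by grind, q, by grind⟩
  have h2 : Lobe G S (X \ A) f := by
    refine ⟨fun a => by grind, ⟨r, by grind⟩, h.mem, by grind, fun a ha b hbS hab => ?_, q, ?_⟩
    · have := fun hbA : b ∈ A => hcl b hbA a (by grind) hab.symm
      grind
    · grind
  refine hG.not_sees (h1.sees hS) (h2.sees hS) (h.compl.sees hS) ?_ ?_ ?_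
  · intro a ha b hb
    have := hcl a ha b
    grind
  · exact h.apart_compl.mono hA (Finset.Subset.refl _)
  · exact h.apart_compl.mono Finset.sdiff_subset (Finset.Subset.refl _)

lemma Lobe.split (hG : NoClaw G) {S X : Finset V} {f : V} (hS : Conn G S) (h : Lobe G S X f) :
    Split G S f X ((S \ X).erase f) := by
  refine ⟨?_, h.notMem, by simp, h.apart_compl, h.conn hG hS, h.compl.conn hG hS, h.sees hS,
    h.compl.sees hS⟩
  have := h.mem
  have := h.subset
  ext a
  grind

lemma Split.lobe {S C D : Finset V} {c : V} (h : Split G S c C D) : Lobe G S C c := by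
  obtain ⟨rfl, hC, hD, hap, hcC, hcD, hsC, hsD⟩ := h
  obtain ⟨d, hd⟩ := hcD.1
  refine ⟨fun a => by grind, hcC.1, by simp, hC, fun a ha b hb hab => ?_, d, ?_⟩
  · have := fun hbD : b ∈ D => (hap a ha b hbD).2 hab
    grind
  · have := fun hdC : d ∈ C => (hap d hdC d hd).1 rfl
    grind

lemma exists_lobe_of_not_conn {S : Finset V} {c : V} (hc : c ∈ S) (hne : (S.erase c).Nonempty)
    (h : ¬ Conn G (S.erase c)) : ∃ X, Lobe G S X c := by
  obtain ⟨A, hA, hAne, ⟨r, hr, hrA⟩, hcl⟩ := exists_closed_of_not_conn hne h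
  exact ⟨A, fun a => by grind, hAne, hc, by grind, fun a ha b hb hab => by grind, r, by grind⟩

lemma conn_erase_of_no_lobe {S : Finset V} {c : V} (hc : c ∈ S) (hne : (S.erase c).Nonempty)
    (h : ∀ X, ¬ Lobe G S X c) : Conn G (S.erase c) := by
  by_contra hn
  obtain ⟨X, hX⟩ := exists_lobe_of_not_conn hc hne hn
  exact h X hX

/-- Source of the recurring dichotomy: a lobe of a part is either seen from outside the part or is a
lobe of the whole. -/
lemma Lobe.lift {U T E : Finset V} {e : V} (h : Lobe G U E e) (hUT : U ⊆ T)
    (hns : ∀ v ∈ T, v ∉ U → ¬ Sees G v E) : Lobe G T E e := by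
  obtain ⟨r, hr, hr'⟩ := h.rest
  refine ⟨h.subset.trans hUT, h.nonempty, hUT h.mem, h.notMem, fun a ha b hb hab => ?_, r, hUT hr, hr'⟩
  by_cases hbU : b ∈ U
  · exact h.boundary a ha b hbU hab
  · exact absurd ⟨a, ha, hab.symm⟩ (hns b hb hbU)

lemma Lobe.exists_leaf {S X : Finset V} {f : V} (h : Lobe G S X f) :
    ∃ E e, Leaf G S E e ∧ E ⊆ X := by
  induction hn : X.card using Nat.strong_induction_on generalizing X f with
  | _ n ih =>
    by_cases hm : ∀ E' e', Lobe G S E' e' → E' ⊆ X → E' = X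
    · exact ⟨X, f, ⟨h, hm⟩, Finset.Subset.refl _⟩
    · push Not at hm
      obtain ⟨E', e', hE', hsub, hne⟩ := hm
      have hlt : E'.card < n := hn ▸ Finset.card_lt_card (Finset.ssubset_iff_subset_ne.2 ⟨hsub, hne⟩)
      obtain ⟨E, e, hE, hEE⟩ := ih _ hlt hE' rfl
      exact ⟨E, e, hE, hEE.trans hsub⟩

/-- No cut vertex lies in a leaf: for `f ∈ E`, intersecting `E` with the side of `f` that avoids `e`
would give a smaller lobe. -/
lemma Leaf.notMem_of_lobe {S E X : Finset V} {e f : V} (hS : Conn G S) (hE : Leaf G S E e)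
    (hX : Lobe G S X f) : f ∉ E := by
  intro hfE
  have key : ∀ X, Lobe G S X f → e ∉ X → False := by
    intro X hX heX
    obtain ⟨x, hx, hfx⟩ := hX.sees hS
    have hxS := hX.subset hx
    have hxE : x ∈ E := by
      have := hE.boundary f hfE x hxS hfx
      grind
    have hl : Lobe G S (E ∩ X) f := by
      refine ⟨fun a ha => hX.subset (by grind), ⟨x, by grind⟩, hX.mem, ?_, fun a ha b hb hab => ?_,
        e, hE.mem, ?_⟩
      · have := hX.notMem
        grind
      · have h1 := hE.boundary a (by grind) b hb hab
        have h2 := hX.boundary a (by grind) b hb hab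
        have := hE.notMem
        grind
      · have := hE.notMem
        grind
    have := hE.minimal _ _ hl Finset.inter_subset_left
    have := hX.notMem
    grind
  by_cases heX : e ∈ X
  · exact key _ hX.compl (by grind)
  · exact key _ hX heX

lemma Leaf.subset_or_apart (hG : NoClaw G) {S E X : Finset V} {e f : V} (hS : Conn G S)
    (hE : Leaf G S E e) (hX : Lobe G S X f) : E ⊆ X ∨ Apart G E X := by
  have hf := hE.notMem_of_lobe hS hX
  have hEc := hE.toLobe.conn hG hS
  by_cases h : ∃ a ∈ E, a ∈ X
  · left
    refine hEc.subset_of_closed h fun a ha haX b hb hab => ?_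
    have := hX.boundary a haX b (hE.subset hb) hab
    grind
  · right
    intro a ha b hb
    push Not at h
    have h1 := fun h => hX.boundary b hb a (hE.subset ha) h
    have := h a ha
    refine ⟨by grind, fun hab => ?_⟩
    have := h1 hab.symm
    grind

/-- Three pairwise separated lobes of a connected set may be taken to be leaves. -/
lemma good_of_leaves {S : Finset V} (hS : Conn G S)
    (h : ∀ E₁ e₁ E₂ e₂ E₃ e₃, Leaf G S E₁ e₁ → Leaf G S E₂ e₂ → Leaf G S E₃ e₃ →
      Apart G E₁ E₂ → Apart G E₁ E₃ → Apart G E₂ E₃ → False) : Good G S := by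
  refine ⟨hS, fun E₁ e₁ E₂ e₂ E₃ e₃ h₁ h₂ h₃ h₁₂ h₁₃ h₂₃ => ?_⟩
  obtain ⟨F₁, f₁, l₁, s₁⟩ := h₁.exists_leaf
  obtain ⟨F₂, f₂, l₂, s₂⟩ := h₂.exists_leaf
  obtain ⟨F₃, f₃, l₃, s₃⟩ := h₃.exists_leaf
  exact h _ _ _ _ _ _ l₁ l₂ l₃ (h₁₂.mono s₁ s₂) (h₁₃.mono s₁ s₃) (h₂₃.mono s₂ s₃)

/-- A connected set is good when its lobes fall into two classes, neither of which contains two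
separated lobes. -/
lemma good_of_classes {U : Finset V} (hU : Conn G U) (p q : Finset V → Prop)
    (hpq : ∀ E e, Lobe G U E e → p E ∨ q E)
    (hp : ∀ E e F f, Lobe G U E e → Lobe G U F f → p E → p F → Apart G E F → False)
    (hq : ∀ E e F f, Lobe G U E e → Lobe G U F f → q E → q F → Apart G E F → False) :
    Good G U := by
  refine ⟨hU, fun E₁ e₁ E₂ e₂ E₃ e₃ h₁ h₂ h₃ h₁₂ h₁₃ h₂₃ => ?_⟩
  rcases hpq _ _ h₁ with a | a <;> rcases hpq _ _ h₂ with b | b <;>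
    rcases hpq _ _ h₃ with c | c
  · exact hp _ _ _ _ h₁ h₂ a b h₁₂
  · exact hp _ _ _ _ h₁ h₂ a b h₁₂
  · exact hp _ _ _ _ h₁ h₃ a c h₁₃
  · exact hq _ _ _ _ h₂ h₃ b c h₂₃
  · exact hp _ _ _ _ h₂ h₃ b c h₂₃
  · exact hq _ _ _ _ h₁ h₃ a c h₁₃
  · exact hq _ _ _ _ h₁ h₂ a b h₁₂
  · exact hq _ _ _ _ h₁ h₂ a b h₁₂

lemma Apart.false_of_mem {A B : Finset V} (h : Apart G A B) {v : V} (hA : v ∈ A) (hB : v ∈ B) :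
    False :=
  (h v hA v hB).1 rfl

/-- A 2-connected set remains good after deletion of any of its vertices. -/
lemma Good.erase_of_no_lobe (hG : NoClaw G) {S : Finset V} (hS : ∀ X f, ¬ Lobe G S X f) {c : V}
    (hconn : Conn G (S.erase c)) : Good G (S.erase c) := by
  -- A lobe not seen by `c` would persist in `S`; three apart lobes are therefore all seen by `c`
  -- and form a claw.
  have key : ∀ E e, Lobe G (S.erase c) E e → Sees G c E := by
    intro E e h
    by_contra hn
    exact hS _ _ (h.lift (Finset.erase_subset _ _) (fun v hv hv' => by
      have : v = c := by grind
      rwa [this]))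
  exact ⟨hconn, fun E₁ e₁ E₂ e₂ E₃ e₃ h₁ h₂ h₃ h₁₂ h₁₃ h₂₃ =>
    hG.not_sees (key _ _ h₁) (key _ _ h₂) (key _ _ h₃) h₁₂ h₁₃ h₂₃⟩

/-! ### Cuts of two and three vertices. -/

/-- The pair `y, d` separates `C` from `D` in the 2-connected set `S`. -/
structure TwoCut (G : SimpleGraph V) (S : Finset V) (y d : V) (C D : Finset V) : Prop where
  no_lobe : ∀ X f, ¬ Lobe G S X f
  eq : S = insert y (insert d (C ∪ D))
  ne : y ≠ d
  y_left : y ∉ C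
  y_right : y ∉ D
  d_left : d ∉ C
  d_right : d ∉ D
  apart : Apart G C D
  conn_left : Conn G C
  conn_right : Conn G D
  y_sees_left : Sees G y C
  y_sees_right : Sees G y D
  d_sees_left : Sees G d C
  d_sees_right : Sees G d D

lemma TwoCut.symm {S C D : Finset V} {y d : V} (h : TwoCut G S y d C D) : TwoCut G S y d D C :=
  ⟨h.no_lobe, by rw [h.eq, Finset.union_comm], h.ne, h.y_right, h.y_left, h.d_right, h.d_left,
    h.apart.symm, h.conn_right, h.conn_left, h.y_sees_right, h.y_sees_left, h.d_sees_right,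
    h.d_sees_left⟩

lemma TwoCut.swap {S C D : Finset V} {y d : V} (h : TwoCut G S y d C D) : TwoCut G S d y C D :=
  ⟨h.no_lobe, by rw [h.eq, Finset.insert_comm], h.ne.symm, h.d_left, h.d_right, h.y_left,
    h.y_right, h.apart, h.conn_left, h.conn_right, h.d_sees_left, h.d_sees_right,
    h.y_sees_left, h.y_sees_right⟩

lemma Split.twoCut {S C D : Finset V} {y d : V} (hS : ∀ X f, ¬ Lobe G S X f) (hy : y ∈ S)
    (h : Split G (S.erase y) d C D) : TwoCut G S y d C D := by
  have hd : d ∈ S.erase y := by rw [h.eq]; simp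
  have key : ∀ {C D}, Split G (S.erase y) d C D → Sees G y C := by
    intro C D h
    by_contra hn
    exact hS _ _ (h.lobe.lift (Finset.erase_subset _ _) (fun v hv hv' => by
      have : v = y := by grind
      rwa [this]))
  have hCD : C ∪ D ⊆ S.erase y := by rw [h.eq]; exact Finset.subset_insert _ _
  refine ⟨hS, ?_, by grind, ?_, ?_, h.notMem_left, h.notMem_right, h.apart, h.conn_left,
    h.conn_right, key h, key h.symm, h.sees_left, h.sees_right⟩
  · rw [← h.eq, Finset.insert_erase hy]
  · have : y ∉ S.erase y := by simp
    grind
  · have : y ∉ S.erase y := by simp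
    grind

lemma Apart.not_sees {A B : Finset V} (h : Apart G A B) {v : V} (hv : v ∈ A) : ¬ Sees G v B :=
  fun ⟨b, hb, hvb⟩ => (h v hv b hb).2 hvb

/-- As `S` has no lobes, each lobe of `C` is seen by `y` or by `d`; each of these also sees `D`, so
it sees at most one of two apart lobes. In the next two lemmas, containing an added cut vertex
replaces being seen by it. -/
lemma TwoCut.good_left (hG : NoClaw G) {S C D : Finset V} {y d : V} (h : TwoCut G S y d C D) :
    Good G C := by
  refine good_of_classes h.conn_left (Sees G y) (Sees G d) ?_ ?_ ?_
  · intro E e hE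
    by_contra! hn
    refine h.no_lobe _ _ (hE.lift (by grind [h.eq]) fun v hv hvC => ?_)
    rw [h.eq] at hv
    simp only [Finset.mem_insert, Finset.mem_union] at hv
    rcases hv with rfl | rfl | hv | hv
    · exact hn.1
    · exact hn.2
    · exact absurd hv hvC
    · exact (h.apart.symm.mono (Finset.Subset.refl _) hE.subset).not_sees hv
  · intro E e F f hE hF sE sF hEF
    exact hG.not_sees sE sF h.y_sees_right hEF (h.apart.mono hE.subset (Finset.Subset.refl _))
      (h.apart.mono hF.subset (Finset.Subset.refl _))
  · intro E e F f hE hF sE sF hEF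
    exact hG.not_sees sE sF h.d_sees_right hEF (h.apart.mono hE.subset (Finset.Subset.refl _))
      (h.apart.mono hF.subset (Finset.Subset.refl _))

lemma Lobe.subset_of_notMem {U E : Finset V} {e y : V} (h : Lobe G (insert y U) E e)
    (hy : y ∉ E) : E ⊆ U := by
  intro a ha
  have := h.subset ha
  grind

lemma TwoCut.good_insert (hG : NoClaw G) {S C D : Finset V} {y d : V} (h : TwoCut G S y d C D) :
    Good G (insert y C) := by
  refine good_of_classes (h.conn_left.insert h.y_sees_left) (fun E => y ∈ E)
    (fun E => y ∉ E ∧ Sees G d E) ?_ ?_ ?_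
  · intro E e hE
    by_contra! hn
    have hEC := hE.subset_of_notMem hn.1
    refine h.no_lobe _ _ (hE.lift (by grind [h.eq]) fun v hv hvC => ?_)
    rw [h.eq] at hv
    simp only [Finset.mem_insert, Finset.mem_union, not_or] at hv hvC
    rcases hv with rfl | rfl | hv | hv
    · exact absurd rfl hvC.1
    · exact hn.2 hn.1
    · exact absurd hv hvC.2
    · exact (h.apart.symm.mono (Finset.Subset.refl _) hEC).not_sees hv
  · intro E e F f hE hF sE sF hEF
    exact hEF.false_of_mem sE sF
  · intro E e F f hE hF sE sF hEF
    exact hG.not_sees sE.2 sF.2 h.d_sees_right hEF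
      (h.apart.mono (hE.subset_of_notMem sE.1) (Finset.Subset.refl _))
      (h.apart.mono (hF.subset_of_notMem sF.1) (Finset.Subset.refl _))

lemma TwoCut.good_insert_insert {S C D : Finset V} {y d : V}
    (h : TwoCut G S y d C D) : Good G (insert y (insert d C)) := by
  refine good_of_classes ((h.conn_left.insert h.d_sees_left).insert
    (h.y_sees_left.mono (Finset.subset_insert _ _))) (fun E => y ∈ E) (fun E => d ∈ E) ?_ ?_ ?_
  · intro E e hE
    by_contra! hn
    have hEC : E ⊆ C := by
      intro a ha
      have := hE.subset ha
      grind
    refine h.no_lobe _ _ (hE.lift (by grind [h.eq]) fun v hv hvC => ?_)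
    rw [h.eq] at hv
    simp only [Finset.mem_insert, Finset.mem_union, not_or] at hv hvC
    rcases hv with rfl | rfl | hv | hv
    · exact absurd rfl hvC.1
    · exact absurd rfl hvC.2.1
    · exact absurd hv hvC.2.2
    · exact (h.apart.symm.mono (Finset.Subset.refl _) hEC).not_sees hv
  · exact fun E e F f hE hF sE sF hEF => hEF.false_of_mem sE sF
  · exact fun E e F f hE hF sE sF hEF => hEF.false_of_mem sE sF

/-- The vertices `y, v, d` with `y ~ v` separate `C` from `D` in the 3-connected set `S`. -/
structure ThreeCut (G : SimpleGraph V) (S : Finset V) (y v d : V) (C D : Finset V) : Prop where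
  no_lobe : ∀ u ∈ S, ∀ X f, ¬ Lobe G (S.erase u) X f
  eq : S = insert y (insert v (insert d (C ∪ D)))
  adj : G.Adj y v
  ne_d : y ≠ d ∧ v ≠ d
  left : y ∉ C ∧ v ∉ C ∧ d ∉ C
  right : y ∉ D ∧ v ∉ D ∧ d ∉ D
  apart : Apart G C D
  conn_left : Conn G C
  conn_right : Conn G D
  sees_left : Sees G y C ∧ Sees G v C ∧ Sees G d C
  sees_right : Sees G y D ∧ Sees G v D ∧ Sees G d D

lemma ThreeCut.symm {S C D : Finset V} {y v d : V} (h : ThreeCut G S y v d C D) :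
    ThreeCut G S y v d D C :=
  ⟨h.no_lobe, by rw [h.eq, Finset.union_comm], h.adj, h.ne_d, h.right, h.left,
    h.apart.symm, h.conn_right, h.conn_left, h.sees_right, h.sees_left⟩

lemma Split.threeCut {S C D : Finset V} {y v d : V} (hS : ∀ u ∈ S, ∀ X f, ¬ Lobe G (S.erase u) X f)
    (hy : y ∈ S) (hv : v ∈ S) (hyv : G.Adj y v)
    (h : Split G ((S.erase y).erase v) d C D) : ThreeCut G S y v d C D := by
  have hne := hyv.ne
  have h1 : TwoCut G (S.erase y) v d C D := h.twoCut (hS y hy) (by grind)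
  have h2 : TwoCut G (S.erase v) y d C D := by
    rw [Finset.erase_right_comm] at h
    exact h.twoCut (hS v hv) (by grind)
  refine ⟨hS, ?_, hyv, ⟨h2.ne, h1.ne⟩, ⟨h2.y_left, h1.y_left, h1.d_left⟩,
    ⟨h2.y_right, h1.y_right, h1.d_right⟩, h1.apart, h1.conn_left, h1.conn_right,
    ⟨h2.y_sees_left, h1.y_sees_left, h1.d_sees_left⟩,
    ⟨h2.y_sees_right, h1.y_sees_right, h1.d_sees_right⟩⟩
  rw [← h1.eq, Finset.insert_erase hy]

/-- In a 3-connected set, a lobe of a part is seen from outside the part, even after one outside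
vertex is disregarded. -/
lemma ThreeCut.sees_of_lobe {S C D U E : Finset V} {y v d e u : V} (h : ThreeCut G S y v d C D)
    (hu : u ∈ S) (huU : u ∉ U) (hUS : U ⊆ S) (hE : Lobe G U E e) :
    ∃ w ∈ S, w ∉ U ∧ w ≠ u ∧ Sees G w E := by
  by_contra! hn
  exact h.no_lobe u hu _ _ (hE.lift (by grind) fun w hw hwU => hn w (by grind) hwU (by grind))

lemma ThreeCut.mem_cases {S C D U E : Finset V} {y v d w : V} (h : ThreeCut G S y v d C D)
    (hE : E ⊆ C) (hU : C ⊆ U) (hw : w ∈ S) (hwU : w ∉ U) (hs : Sees G w E) :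
    w = y ∨ w = v ∨ w = d := by
  rw [h.eq] at hw
  simp only [Finset.mem_insert, Finset.mem_union] at hw
  rcases hw with hw | hw | hw | hw | hw
  · exact Or.inl hw
  · exact Or.inr (Or.inl hw)
  · exact Or.inr (Or.inr hw)
  · exact absurd (hU hw) hwU
  · exact absurd hs ((h.apart.symm.mono (Finset.Subset.refl _) hE).not_sees hw)

/-- Two classes suffice for three cut vertices because 3-connectivity allows one of them, here `v`,
to be disregarded. -/
lemma ThreeCut.good_left (hG : NoClaw G) {S C D : Finset V} {y v d : V}
    (h : ThreeCut G S y v d C D) : Good G C := by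
  have hCS : C ⊆ S := by grind [h.eq]
  have hy : y ∈ S := by grind [h.eq]
  have hv : v ∈ S := by grind [h.eq]
  have hd : d ∈ S := by grind [h.eq]
  obtain ⟨hyC, hvC, hdC⟩ := h.left
  refine good_of_classes h.conn_left (Sees G y) (Sees G d) ?_ ?_ ?_
  · intro E e hE
    obtain ⟨w, hw, hwC, hwv, hs⟩ := h.sees_of_lobe hv hvC hCS hE
    rcases h.mem_cases hE.subset (Finset.Subset.refl _) hw hwC hs with rfl | rfl | rfl
    · exact Or.inl hs
    · exact absurd rfl hwv
    · exact Or.inr hs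
  · intro E e F f hE hF sE sF hEF
    exact hG.not_sees sE sF h.sees_right.1 hEF (h.apart.mono hE.subset (Finset.Subset.refl _))
      (h.apart.mono hF.subset (Finset.Subset.refl _))
  · intro E e F f hE hF sE sF hEF
    exact hG.not_sees sE sF h.sees_right.2.2 hEF (h.apart.mono hE.subset (Finset.Subset.refl _))
      (h.apart.mono hF.subset (Finset.Subset.refl _))

lemma ThreeCut.good_insert_d (hG : NoClaw G) {S C D : Finset V} {y v d : V}
    (h : ThreeCut G S y v d C D) : Good G (insert d C) := by
  have hCS : insert d C ⊆ S := by grind [h.eq]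
  have hv : v ∈ S := by grind [h.eq]
  have hvC : v ∉ insert d C := by grind [h.left, h.ne_d]
  refine good_of_classes (h.conn_left.insert h.sees_left.2.2) (fun E => d ∈ E)
    (fun E => d ∉ E ∧ Sees G y E) ?_ ?_ ?_
  · intro E e hE
    by_cases hdE : d ∈ E
    · exact Or.inl hdE
    · right
      obtain ⟨w, hw, hwC, hwv, hs⟩ := h.sees_of_lobe hv hvC hCS hE
      rcases h.mem_cases (hE.subset_of_notMem hdE) (Finset.subset_insert _ _) hw hwC hs
        with rfl | rfl | rfl
      · exact ⟨hdE, hs⟩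
      · exact absurd rfl hwv
      · simp at hwC
  · exact fun E e F f hE hF sE sF hEF => hEF.false_of_mem sE sF
  · intro E e F f hE hF sE sF hEF
    exact hG.not_sees sE.2 sF.2 h.sees_right.1 hEF
      (h.apart.mono (hE.subset_of_notMem sE.1) (Finset.Subset.refl _))
      (h.apart.mono (hF.subset_of_notMem sF.1) (Finset.Subset.refl _))

lemma ThreeCut.good_insert_yv {S C D : Finset V} {y v d : V}
    (h : ThreeCut G S y v d C D) : Good G (insert y (insert v C)) := by
  have hCS : insert y (insert v C) ⊆ S := by grind [h.eq]
  have hd : d ∈ S := by grind [h.eq]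
  have hdC : d ∉ insert y (insert v C) := by grind [h.left, h.ne_d]
  refine good_of_classes ((h.conn_left.insert h.sees_left.2.1).insert
    (h.sees_left.1.mono (Finset.subset_insert _ _))) (fun E => y ∈ E) (fun E => v ∈ E) ?_ ?_ ?_
  · intro E e hE
    by_contra! hn
    have hEC : E ⊆ C := by
      intro a ha
      have := hE.subset ha
      grind
    obtain ⟨w, hw, hwC, hwd, hs⟩ := h.sees_of_lobe hd hdC hCS hE
    rcases h.mem_cases hEC (by grind) hw hwC hs with rfl | rfl | rfl
    · simp at hwC
    · simp at hwC
    · exact hwd rfl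
  · exact fun E e F f hE hF sE sF hEF => hEF.false_of_mem sE sF
  · exact fun E e F f hE hF sE sF hEF => hEF.false_of_mem sE sF

lemma ThreeCut.good_insert_yvd {S C D : Finset V} {y v d : V}
    (h : ThreeCut G S y v d C D) : Good G (insert y (insert v (insert d C))) := by
  have hCS : insert y (insert v (insert d C)) ⊆ S := by grind [h.eq]
  refine good_of_classes (((h.conn_left.insert h.sees_left.2.2).insert
    (h.sees_left.2.1.mono (Finset.subset_insert _ _))).insert
    (h.sees_left.1.mono (by grind))) (fun E => y ∈ E ∨ v ∈ E)
    (fun E => d ∈ E) ?_ ?_ ?_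
  · intro E e hE
    by_contra! hn
    have hEC : E ⊆ C := by
      intro a ha
      have := hE.subset ha
      grind
    -- The disregarded vertex has to lie outside the part, which now contains `y`, `v`, `d`; any
    -- vertex of `D` serves.
    obtain ⟨x, hx⟩ := h.conn_right.1
    have hxC : x ∉ C := fun hxC => h.apart.false_of_mem hxC hx
    obtain ⟨w, hw, hwC, hwd, hs⟩ := h.sees_of_lobe (u := x) (by grind [h.eq])
      (by grind [h.right]) hCS hE
    have := h.mem_cases hEC (by grind) hw hwC hs
    grind
  -- The adjacency of `y` and `v` is needed here: two apart lobes cannot each contain one of them.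
  · intro E e F f hE hF sE sF hEF
    have h1 := hEF y
    have h2 := hEF v
    have h3 := h.adj
    have h4 := h3.symm
    grind
  · exact fun E e F f hE hF sE sF hEF => hEF.false_of_mem sE sF

/-! ### Pieces of a good set at a cut vertex. -/

lemma Split.good_left (hG : NoClaw G) {S C D : Finset V} {c : V} (hS : Good G S)
    (h : Split G S c C D) : Good G C := by
  -- Two apart lobes seen by `c` form a claw with `D`; two unseen ones are lobes of `S`, and with
  -- `D` make three.
  refine good_of_classes h.conn_left (Sees G c) (fun E => ¬ Sees G c E)
    (fun E _ _ => Classical.em _) ?_ ?_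
  · intro E e F f hE hF sE sF hEF
    exact hG.not_sees sE sF h.sees_right hEF (h.apart.mono hE.subset (Finset.Subset.refl _))
      (h.apart.mono hF.subset (Finset.Subset.refl _))
  · have key : ∀ E e, Lobe G C E e → ¬ Sees G c E → Lobe G S E e := by
      intro E e hE hn
      refine hE.lift (by grind [h.eq]) fun v hv hvC => ?_
      rw [h.eq] at hv
      simp only [Finset.mem_insert, Finset.mem_union] at hv
      rcases hv with rfl | hv | hv
      · exact hn
      · exact absurd hv hvC
      · exact (h.apart.symm.mono (Finset.Subset.refl _) hE.subset).not_sees hv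
    intro E e F f hE hF sE sF hEF
    exact hS.2 _ _ _ _ _ _ (key _ _ hE sE) (key _ _ hF sF) h.symm.lobe hEF
      (h.apart.mono hE.subset (Finset.Subset.refl _))
      (h.apart.mono hF.subset (Finset.Subset.refl _))

/-- Lobes of `C + c` extend to lobes of `S` without losing apartness: one containing `c` absorbs
`D`, and any other is unchanged. -/
lemma Split.good_insert {S C D : Finset V} {c : V} (hS : Good G S)
    (h : Split G S c C D) : Good G (insert c C) := by
  have hU := h.conn_left.insert h.sees_left
  have hsub : insert c C ⊆ S := by grind [h.eq]
  have key : ∀ E e, Lobe G (insert c C) E e →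
      ∃ F f, Lobe G S F f ∧ E ⊆ F ∧ F ⊆ E ∪ D ∧ (c ∉ E → F = E) := by
    intro E e hE
    by_cases hc : c ∈ E
    · refine ⟨E ∪ D, e, ⟨by grind [h.eq, hE.subset], hE.nonempty.mono Finset.subset_union_left,
        hsub hE.mem, ?_, ?_, ?_⟩, Finset.subset_union_left, Finset.Subset.refl _, absurd hc⟩
      · intro he
        have := h.apart e
        grind [hE.mem, hE.notMem]
      · intro a ha b hb hab
        have := hE.boundary a
        have h1 := fun hb' ha' => (h.apart b hb' a ha').2 hab.symm
        grind [h.eq]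
      · obtain ⟨r, hr, hr', hre⟩ := hE.rest
        have := h.apart r
        exact ⟨r, hsub hr, by grind, hre⟩
    · refine ⟨E, e, hE.lift hsub fun v hv hvC => ?_, Finset.Subset.refl _,
        Finset.subset_union_left, fun _ => rfl⟩
      have : v ∈ D := by grind [h.eq]
      exact (h.apart.symm.mono (Finset.Subset.refl _) (hE.subset_of_notMem hc)).not_sees this
  have hap : ∀ E e F f E' F', Lobe G (insert c C) E e → Lobe G (insert c C) F f → Apart G E F →
      E' ⊆ E ∪ D → F' ⊆ F ∪ D → (c ∉ E → E' = E) → (c ∉ F → F' = F) → Apart G E' F' := by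
    intro E e F f E' F' hE hF hEF hE' hF' cE cF
    by_cases h1 : c ∈ E
    · have h2 : c ∉ F := fun h2 => hEF.false_of_mem h1 h2
      rw [cF h2]
      intro a ha b hb
      have h3 := hF.subset_of_notMem h2 hb
      have h4 := h.apart b h3 a
      have h5 := fun ha => hEF a ha b hb
      have h6 := G.adj_comm a b
      grind
    · rw [cE h1]
      intro a ha b hb
      have h3 := hE.subset_of_notMem h1 ha
      have h4 := h.apart a h3 b
      have h5 := hEF a ha b
      grind
  refine ⟨hU, fun E₁ e₁ E₂ e₂ E₃ e₃ h₁ h₂ h₃ h₁₂ h₁₃ h₂₃ => ?_⟩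
  obtain ⟨F₁, f₁, l₁, -, s₁, c₁⟩ := key _ _ h₁
  obtain ⟨F₂, f₂, l₂, -, s₂, c₂⟩ := key _ _ h₂
  obtain ⟨F₃, f₃, l₃, -, s₃, c₃⟩ := key _ _ h₃
  exact hS.2 _ _ _ _ _ _ l₁ l₂ l₃ (hap _ _ _ _ _ _ h₁ h₂ h₁₂ s₁ s₂ c₁ c₂)
    (hap _ _ _ _ _ _ h₁ h₃ h₁₃ s₁ s₃ c₁ c₃) (hap _ _ _ _ _ _ h₂ h₃ h₂₃ s₂ s₃ c₂ c₃)

/-- Since `c` cuts the set, no leaf contains it; a leaf is then `{w}` or a lobe of `S` inside `C`.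
Two apart leaves inside `C` would join `D` as three lobes of `S`. -/
lemma Split.good_insert_insert (hG : NoClaw G) {S C D : Finset V} {c w : V} (hS : Good G S)
    (h : Split G S c C D) (hw : w ∈ D) (hcw : G.Adj c w) : Good G (insert w (insert c C)) := by
  have hU : Conn G (insert w (insert c C)) :=
    (h.conn_left.insert h.sees_left).insert ⟨c, by simp, hcw.symm⟩
  have hwC : w ∉ C := fun hwC => h.apart.false_of_mem hwC hw
  have hwc := hcw.ne
  have hsub : insert w (insert c C) ⊆ S := by grind [h.eq]
  have hC : Lobe G (insert w (insert c C)) C c := by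
    refine ⟨by grind, h.conn_left.1, by simp, h.notMem_left, fun a ha b hb hab => ?_, w, ?_⟩
    · have := (h.apart a ha w hw).2
      grind
    · grind
  refine good_of_leaves hU fun E₁ e₁ E₂ e₂ E₃ e₃ h₁ h₂ h₃ h₁₂ h₁₃ h₂₃ => ?_
  have key : ∀ E e, Leaf G (insert w (insert c C)) E e → E ⊆ C ∧ Lobe G S E e ∨ E = {w} := by
    intro E e hE
    have hc := hE.notMem_of_lobe hU hC
    rcases hE.subset_or_apart hG hU hC with h1 | h1
    · refine Or.inl ⟨h1, hE.toLobe.lift hsub fun v hv hv' => ?_⟩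
      have : v ∈ D := by grind [h.eq]
      exact (h.apart.symm.mono (Finset.Subset.refl _) h1).not_sees this
    · right
      apply (Finset.Nonempty.subset_singleton_iff hE.nonempty).1
      intro a ha
      have := hE.subset ha
      have := fun haC : a ∈ C => h1.false_of_mem ha haC
      grind
  have hmem : ∀ {E F : Finset V}, Apart G E F → E = {w} → F = {w} → False := by
    rintro E F hEF rfl rfl
    exact hEF.false_of_mem (v := w) (by simp) (by simp)
  have fin : ∀ E e F f, (E ⊆ C ∧ Lobe G S E e) → (F ⊆ C ∧ Lobe G S F f) → Apart G E F → False := by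
    intro E e F f hE hF hEF
    exact hS.2 _ _ _ _ _ _ hE.2 hF.2 h.symm.lobe hEF
      (h.apart.mono hE.1 (Finset.Subset.refl _)) (h.apart.mono hF.1 (Finset.Subset.refl _))
  rcases key _ _ h₁ with a | a <;> rcases key _ _ h₂ with b | b <;>
    rcases key _ _ h₃ with c | c
  · exact fin _ _ _ _ a b h₁₂
  · exact fin _ _ _ _ a b h₁₂
  · exact fin _ _ _ _ a c h₁₃
  · exact hmem h₂₃ b c
  · exact fin _ _ _ _ b c h₂₃
  · exact hmem h₁₃ a c
  · exact hmem h₁₂ a b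
  · exact hmem h₁₂ a b

/-- Some neighbour of the cut vertex can be deleted from its side without disconnecting it. -/
lemma Split.exists_conn_erase (hG : NoClaw G) {S C D : Finset V} {c : V} (hS : Good G S)
    (h : Split G S c C D) (hD : 2 ≤ D.card)
    (hmod : ∀ w A B, Split G S w A B → A.card % 3 = 1) :
    ∃ w ∈ D, G.Adj c w ∧ Conn G (D.erase w) := by
  by_contra! hn
  -- Of the two sides of `D - w`, the vertex `c` misses at least one, since it also sees `C`; the
  -- missed side is a lobe of `S`.
  have key : ∀ w ∈ D, G.Adj c w → ∃ B, B ⊆ D ∧ Lobe G S B w ∧ ¬ Sees G c B := by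
    intro w hw hcw
    have hne : (D.erase w).Nonempty := by
      rw [← Finset.card_pos, Finset.card_erase_of_mem hw]
      omega
    have lift : ∀ B, Lobe G D B w → ¬ Sees G c B → Lobe G S B w := by
      intro B hB hs
      refine hB.lift (by grind [h.eq]) fun v hv hvD => ?_
      rw [h.eq] at hv
      simp only [Finset.mem_insert, Finset.mem_union] at hv
      rcases hv with rfl | hv | hv
      · exact hs
      · exact (h.apart.mono (Finset.Subset.refl _) hB.subset).not_sees hv
      · exact absurd hv hvD
    obtain ⟨B, hB⟩ := exists_lobe_of_not_conn hw hne (hn w hw hcw)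
    by_cases hs : Sees G c B
    · have hs' : ¬ Sees G c ((D \ B).erase w) := fun hs' =>
        hG.not_sees hs hs' h.sees_left hB.apart_compl
          (h.apart.symm.mono hB.subset (Finset.Subset.refl _))
          (h.apart.symm.mono hB.compl.subset (Finset.Subset.refl _))
      exact ⟨_, hB.compl.subset, lift _ hB.compl hs', hs'⟩
    · exact ⟨B, hB.subset, lift _ hB hs, hs⟩
  obtain ⟨w, hw, hcw⟩ := h.sees_right
  obtain ⟨B, hBD, hB, hcB⟩ := key w hw hcw
  have hwS := hB.split hG hS.1
  have hcS : c ∈ S := by grind [h.eq]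
  have hsub : insert c C ⊆ (S \ B).erase w := by
    intro a ha
    have := fun haC haB => h.apart.false_of_mem (v := a) haC (hBD haB)
    have := h.notMem_right
    have := fun haC => h.apart.false_of_mem (v := a) haC
    grind [h.eq]
  -- Otherwise `C` and `C + c` would both be sides of splits, with sizes both 1 mod 3. The edge
  -- leaving `C + c` thus yields a second neighbour `w'` of `c`, whose lobe, with `B` and `C`,
  -- violates goodness.
  have hex : ∃ r ∈ (S \ B).erase w, r ∉ insert c C := by
    by_contra! hno
    have h1 : insert c C = (S \ B).erase w := Finset.Subset.antisymm hsub hno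
    have h2 := hmod _ _ _ h
    have h3 := hmod _ _ _ hwS.symm
    rw [← h1, Finset.card_insert_of_notMem h.notMem_left] at h3
    omega
  obtain ⟨a, ha, w', hw', hw'C, haw'⟩ := hwS.conn_right.exists_adj hsub (by simp) hex
  have hw'D : w' ∈ D := by grind [h.eq]
  have hcw' : G.Adj c w' := by
    have := fun haC => (h.apart a haC w' hw'D).2
    grind
  obtain ⟨B', hBD', hB', hcB'⟩ := key w' hw'D hcw'
  have hwB' : w ∉ B' := fun hh => hcB' ⟨w, hh, hcw⟩
  have hdis : ∀ a ∈ B, a ∉ B' := by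
    intro a ha haB'
    have hsub' : B ⊆ B' := hwS.conn_left.subset_of_closed ⟨a, ha, haB'⟩ (by
      intro x hx hxB' y hy hxy
      have := hB'.boundary x hxB' y (hB.subset hy) hxy
      grind)
    obtain ⟨b, hb, hwb⟩ := hwS.sees_left
    have := hB'.boundary b (hsub' hb) w hB.mem hwb.symm
    grind
  refine hS.2 _ _ _ _ _ _ hB hB' h.lobe ?_ (h.apart.symm.mono hBD (Finset.Subset.refl _))
    (h.apart.symm.mono hBD' (Finset.Subset.refl _))
  intro a ha b hb
  refine ⟨fun hab => hdis a ha (hab ▸ hb), fun hab => ?_⟩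
  have := hB'.boundary b hb a (hB.subset ha) hab.symm
  have := hdis a ha
  grind

/-! ### The exceptional case at a cut vertex: `D - w` has three end-blocks. -/

/-- The vertex `w` is a neighbour in `D` of the cut vertex `c`, and `D - w` is connected. -/
structure Branch (G : SimpleGraph V) (S C D : Finset V) (c w : V) : Prop where
  noClaw : NoClaw G
  good : Good G S
  cut : Split G S c C D
  mem : w ∈ D
  adj : G.Adj c w
  conn : Conn G (D.erase w)

namespace Branch

variable {S C D E F : Finset V} {c w e f : V}

lemma apart_C (h : Branch G S C D c w) (hE : E ⊆ D.erase w) : Apart G E C :=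
  h.cut.apart.symm.mono (hE.trans (Finset.erase_subset _ _)) (Finset.Subset.refl _)

/-- Otherwise `c` would be the centre of a claw with ends in `E`, at `w` and in `C`. -/
lemma sees_w (h : Branch G S C D c w) (hE : E ⊆ D.erase w) (hs : Sees G c E) : Sees G w E := by
  by_contra hn
  refine h.noClaw.not_sees (A := E) (B := {w}) (C := C) hs ⟨w, by simp, h.adj⟩ h.cut.sees_left ?_
    (h.apart_C hE) (h.cut.apart.symm.mono (by simpa using h.mem) (Finset.Subset.refl _))
  intro a ha b hb
  obtain rfl := Finset.mem_singleton.1 hb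
  exact ⟨by grind, fun hab => hn ⟨a, ha, hab.symm⟩⟩

lemma lobe_of_not_sees (h : Branch G S C D c w) (hE : Lobe G (D.erase w) E e)
    (hs : ¬ Sees G w E) : Lobe G S E e := by
  refine hE.lift (by grind [h.cut.eq]) fun v hv hvD => ?_
  rw [h.cut.eq] at hv
  simp only [Finset.mem_insert, Finset.mem_union] at hv
  rcases hv with rfl | hv | hv
  · exact fun hc => hs (h.sees_w hE.subset hc)
  · exact (h.apart_C hE.subset).symm.not_sees hv
  · have : v = w := by grind
    rwa [this]

/-- A lobe that `w` misses is also missed by `c`, so it is a lobe of `S`; two such together with `C`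
are too many. -/
lemma sees_or_sees (h : Branch G S C D c w) (hE : Lobe G (D.erase w) E e)
    (hF : Lobe G (D.erase w) F f) (hEF : Apart G E F) : Sees G w E ∨ Sees G w F := by
  by_contra! hn
  exact h.good.2 _ _ _ _ _ _ (h.lobe_of_not_sees hE hn.1) (h.lobe_of_not_sees hF hn.2)
    h.cut.lobe hEF (h.apart_C hE.subset) (h.apart_C hF.subset)

lemma not_sees_both (h : Branch G S C D c w) (hE : E ⊆ D.erase w) (hF : F ⊆ D.erase w)
    (hEF : Apart G E F) (hsE : Sees G c E) (hsF : Sees G c F) : False :=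
  h.noClaw.not_sees hsE hsF h.cut.sees_left hEF (h.apart_C hE) (h.apart_C hF)

lemma c_notMem (h : Branch G S C D c w) (hE : E ⊆ D.erase w) : c ∉ E := by
  have := h.cut.notMem_right
  grind

lemma apart_c (h : Branch G S C D c w) (hE : E ⊆ D.erase w) (hs : ¬ Sees G c E) :
    Apart G E {c} := by
  intro a ha b hb
  obtain rfl := Finset.mem_singleton.1 hb
  have := h.c_notMem hE
  exact ⟨by grind, fun hab => hs ⟨a, ha, hab.symm⟩⟩

lemma c_sees (h : Branch G S C D c w) (hE : E ⊆ D.erase w) (hF : F ⊆ D.erase w)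
    (hEF : Apart G E F) (hsE : Sees G w E) (hsF : Sees G w F) : Sees G c E ∨ Sees G c F := by
  by_contra! hn
  exact h.noClaw.not_sees (C := {c}) hsE hsF ⟨c, by simp, h.adj.symm⟩ hEF
    (h.apart_c hE hn.1) (h.apart_c hF hn.2)

end Branch

/-- A lobe of `D - w` seen by `w` but not by `c`, accompanied by two further lobes. -/
def Candidate (G : SimpleGraph V) (D : Finset V) (c w : V) (X : Finset V) : Prop :=
  Sees G w X ∧ ¬ Sees G c X ∧ ∃ d E₂ e₂ E₃ e₃, Lobe G (D.erase w) X d ∧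
    Lobe G (D.erase w) E₂ e₂ ∧ Lobe G (D.erase w) E₃ e₃ ∧ Apart G X E₂ ∧ Apart G X E₃ ∧
    Apart G E₂ E₃

/-- A largest lobe `X` of `D - w` seen by `w` but not by `c`, its complement `Y` beyond the cut
vertex `d`, and two further lobes in `Y`. -/
structure Arm (G : SimpleGraph V) (S C D : Finset V) (c w : V) (X : Finset V) (d : V)
    (Y E₂ : Finset V) (e₂ : V) (E₃ : Finset V) (e₃ : V) : Prop
    extends Branch G S C D c w where
  split : Split G (D.erase w) d X Y
  sees_X : Sees G w X
  not_sees_X : ¬ Sees G c X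
  leaf : Leaf G (D.erase w) E₂ e₂
  sees_leaf : Sees G c E₂
  lobe : Lobe G (D.erase w) E₃ e₃
  not_sees_lobe : ¬ Sees G w E₃
  leaf_sub : E₂ ⊆ Y
  lobe_sub : E₃ ⊆ Y
  apart' : Apart G E₂ E₃
  maximal : ∀ X', Candidate G D c w X' → X'.card ≤ X.card

lemma Split.subset_of_apart {T X Y E : Finset V} {d : V} (h : Split G T d X Y) (hE : E ⊆ T)
    (hap : Apart G X E) : E ⊆ Y := by
  intro a ha
  have haT := hE ha
  rw [h.eq] at haT
  obtain ⟨x, hx, hdx⟩ := h.sees_left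
  have h1 := (hap x hx a ha).2
  have h2 := fun haX => hap.false_of_mem (v := a) haX ha
  have h3 := hdx.symm
  grind

/-- Among three apart lobes `w` sees at least two, and `c` sees at most one of those, so a candidate
exists; a largest one is taken. Of its two companions `w` sees exactly one, and by the claw
condition at `w` that one is seen by `c`. -/
lemma Branch.exists_arm {S C D : Finset V} {c w : V} (h : Branch G S C D c w)
    (hbad : ¬ Good G (D.erase w)) : ∃ X d Y E₂ e₂ E₃ e₃, Arm G S C D c w X d Y E₂ e₂ E₃ e₃ := by
  classical
  have hex : ∃ X, Candidate G D c w X := by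
    by_contra! hn
    refine hbad ⟨h.conn, fun E₁ e₁ E₂ e₂ E₃ e₃ h₁ h₂ h₃ h₁₂ h₁₃ h₂₃ => ?_⟩
    have key : ∀ {E e F f H k}, Lobe G (D.erase w) E e → Lobe G (D.erase w) F f →
        Lobe G (D.erase w) H k → Apart G E F → Apart G E H → Apart G F H →
        Sees G w E → Sees G w F → False := by
      intro E e F f H k hE hF hH hEF hEH hFH sE sF
      by_cases hcE : Sees G c E
      · have hcF : ¬ Sees G c F := fun hcF => h.not_sees_both hE.subset hF.subset hEF hcE hcF
        exact hn F ⟨sF, hcF, f, E, e, H, k, hF, hE, hH, hEF.symm, hFH, hEH⟩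
      · exact hn E ⟨sE, hcE, e, F, f, H, k, hE, hF, hH, hEF, hEH, hFH⟩
    have a := h.sees_or_sees h₁ h₂ h₁₂
    have b := h.sees_or_sees h₁ h₃ h₁₃
    have c := h.sees_or_sees h₂ h₃ h₂₃
    by_cases s₁ : Sees G w E₁
    · rcases c with s₂ | s₃
      · exact key h₁ h₂ h₃ h₁₂ h₁₃ h₂₃ s₁ s₂
      · exact key h₁ h₃ h₂ h₁₃ h₁₂ h₂₃.symm s₁ s₃
    · exact key h₂ h₃ h₁ h₂₃ h₁₂.symm h₁₃.symm (a.resolve_left s₁) (b.resolve_left s₁)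
  obtain ⟨X, hX, hmax⟩ : ∃ X, Candidate G D c w X ∧ ∀ X', Candidate G D c w X' →
      X'.card ≤ X.card := by
    obtain ⟨X₀, h₀⟩ := hex
    have hsub : ∀ X, Candidate G D c w X → X ∈ D.powerset.filter (Candidate G D c w) := by
      intro X hX
      obtain ⟨-, -, d, -, -, -, -, hl, -⟩ := id hX
      simp only [Finset.mem_filter, Finset.mem_powerset]
      exact ⟨hl.subset.trans (Finset.erase_subset _ _), hX⟩
    obtain ⟨X, hX, hm⟩ := Finset.exists_max_image (D.powerset.filter (Candidate G D c w))
      Finset.card ⟨X₀, hsub _ h₀⟩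
    exact ⟨X, (Finset.mem_filter.1 hX).2, fun X' hX' => hm X' (hsub _ hX')⟩
  obtain ⟨sX, cX, d, E₂, e₂, E₃, e₃, hXd, h₂, h₃, hX2, hX3, h23⟩ := hX
  have hsp := hXd.split h.noClaw h.conn
  have key : ∀ {E e F f}, Lobe G (D.erase w) E e → Lobe G (D.erase w) F f → Apart G X E →
      Apart G X F → Apart G E F → Sees G w E → ∃ X d Y E₂ e₂ E₃ e₃,
        Arm G S C D c w X d Y E₂ e₂ E₃ e₃ := by
    intro E e F f hE hF hXE hXF hEF sE
    have hwF : ¬ Sees G w F := fun sF => h.noClaw.not_sees sX sE sF hXE hXF hEF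
    obtain ⟨E', e', hE', hsub⟩ := hE.exists_leaf
    have hwE' := (h.sees_or_sees hE'.toLobe hF (hEF.mono hsub (Finset.Subset.refl _))).resolve_right
      hwF
    have hXE' := hXE.mono (Finset.Subset.refl _) hsub
    refine ⟨X, d, _, E', e', F, f, h, hsp, sX, cX, hE', ?_, hF, hwF, ?_, ?_, ?_, hmax⟩
    · exact (h.c_sees hXd.subset hE'.subset hXE' sX hwE').resolve_left cX
    · exact hsp.subset_of_apart hE'.subset hXE'
    · exact hsp.subset_of_apart hF.subset hXF
    · exact hEF.mono hsub (Finset.Subset.refl _)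
  rcases h.sees_or_sees h₂ h₃ h23 with s | s
  · exact key h₂ h₃ hX2 hX3 h23 s
  · exact key h₃ h₂ hX3 hX2 h23.symm s

namespace Arm

variable {S C D X Y E₂ E₃ E F H : Finset V} {c w d e₂ e₃ e f k : V}

lemma eq_T (h : Arm G S C D c w X d Y E₂ e₂ E₃ e₃) : D.erase w = insert d (X ∪ Y) := h.split.eq

lemma X_sub (h : Arm G S C D c w X d Y E₂ e₂ E₃ e₃) : X ⊆ D.erase w := by
  rw [h.eq_T]; grind

lemma Y_sub (h : Arm G S C D c w X d Y E₂ e₂ E₃ e₃) : Y ⊆ D.erase w := by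
  rw [h.eq_T]; grind

lemma no_lobe_in_X (h : Arm G S C D c w X d Y E₂ e₂ E₃ e₃) (hE : E ⊆ X) (hl : Lobe G S E e) :
    False :=
  h.good.2 _ _ _ _ _ _ hl (h.lobe_of_not_sees h.lobe h.not_sees_lobe) h.cut.lobe
    (h.split.apart.mono hE h.lobe_sub) (h.apart_C (hE.trans h.X_sub)) (h.apart_C h.lobe.subset)

lemma c_sees_of_Y (h : Arm G S C D c w X d Y E₂ e₂ E₃ e₃) (hF : F ⊆ Y) (hs : Sees G w F) :
    Sees G c F :=
  (h.c_sees h.X_sub (hF.trans h.Y_sub)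
    (h.split.apart.mono (Finset.Subset.refl _) hF) h.sees_X hs).resolve_left h.not_sees_X

/-- `w`, and hence `c`, sees `F` or `H`, so `c` cannot also see `E`. Then `E` is a candidate larger
than `X`. -/
lemma no_bigger (h : Arm G S C D c w X d Y E₂ e₂ E₃ e₃) (hE : Lobe G (D.erase w) E e)
    (hF : Lobe G (D.erase w) F f) (hH : Lobe G (D.erase w) H k) (hX : insert d X ⊆ E)
    (hFY : F ⊆ Y) (hHY : H ⊆ Y) (hEF : Apart G E F) (hEH : Apart G E H) (hFH : Apart G F H) :
    False := by
  have hns : ¬ Sees G c E := by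
    intro hs
    rcases h.sees_or_sees hF hH hFH with s | s
    · exact h.not_sees_both hE.subset hF.subset hEF hs (h.c_sees_of_Y hFY s)
    · exact h.not_sees_both hE.subset hH.subset hEH hs (h.c_sees_of_Y hHY s)
  have h1 := h.maximal E ⟨h.sees_X.mono (by grind), hns, e, F, f, H, k, hE, hF, hH, hEF, hEH, hFH⟩
  have h2 := Finset.card_le_card hX
  rw [Finset.card_insert_of_notMem h.split.notMem_left] at h2
  omega

/-- `w` sees at least two of the three lobes, and `X` besides: a claw. -/
lemma no_four (h : Arm G S C D c w X d Y E₂ e₂ E₃ e₃) (hE : Lobe G (D.erase w) E e)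
    (hF : Lobe G (D.erase w) F f) (hH : Lobe G (D.erase w) H k) (hEY : E ⊆ Y)
    (hFY : F ⊆ Y) (hHY : H ⊆ Y) (hEF : Apart G E F) (hEH : Apart G E H) (hFH : Apart G F H) :
    False := by
  have key : ∀ {E F : Finset V}, E ⊆ Y → F ⊆ Y → Apart G E F → Sees G w E → Sees G w F → False :=
    fun hE hF hEF sE sF => h.noClaw.not_sees h.sees_X sE sF
      (h.split.apart.mono (Finset.Subset.refl _) hE)
      (h.split.apart.mono (Finset.Subset.refl _) hF) hEF
  rcases h.sees_or_sees hE hF hEF with a | a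
  · rcases h.sees_or_sees hF hH hFH with b | b
    · exact key hEY hFY hEF a b
    · exact key hEY hHY hEH a b
  · rcases h.sees_or_sees hE hH hEH with b | b
    · exact key hEY hFY hEF b a
    · exact key hFY hHY hFH a b

/-- Vertices of `S` by position. -/
lemma mem_S (h : Arm G S C D c w X d Y E₂ e₂ E₃ e₃) (v : V) :
    v ∈ S ↔ v = c ∨ v ∈ C ∨ v = w ∨ v = d ∨ v ∈ X ∨ v ∈ Y := by
  have h1 : v ∈ D.erase w ↔ v ∈ insert d (X ∪ Y) := by rw [h.eq_T]
  have := h.mem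
  rw [h.cut.eq]
  grind

lemma ne_w (h : Arm G S C D c w X d Y E₂ e₂ E₃ e₃) : d ≠ w ∧ w ∉ X ∧ w ∉ Y := by
  have : w ∉ D.erase w := by simp
  rw [h.eq_T] at this
  grind

lemma not_sees_C (h : Arm G S C D c w X d Y E₂ e₂ E₃ e₃) (hE : E ⊆ D.erase w) (v : V)
    (hv : v ∈ C) : ¬ Sees G v E :=
  (h.apart_C hE).symm.not_sees hv

lemma not_sees_c (h : Arm G S C D c w X d Y E₂ e₂ E₃ e₃) (hE : E ⊆ X) : ¬ Sees G c E :=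
  fun hs => h.not_sees_X (hs.mono hE)

lemma lift_X (h : Arm G S C D c w X d Y E₂ e₂ E₃ e₃) {U : Finset V} (hU : U ⊆ S) (hE : E ⊆ X)
    (hl : Lobe G U E e) (hw : w ∈ U ∨ ¬ Sees G w E) (hd : d ∈ U ∨ ¬ Sees G d E) (hXU : X ⊆ U) :
    False := by
  refine h.no_lobe_in_X hE (hl.lift hU fun v hv hvU => ?_)
  rcases (h.mem_S v).1 hv with rfl | hv | rfl | rfl | hv | hv
  · exact h.not_sees_c hE
  · exact h.not_sees_C (hE.trans h.X_sub) v hv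
  · exact hw.resolve_left hvU
  · exact hd.resolve_left hvU
  · exact absurd (hXU hv) hvU
  · exact (h.split.apart.symm.mono (Finset.Subset.refl _) hE).not_sees hv

/-- `c` sees nothing in `X`, so it would be the third end of a claw at `w`. -/
lemma not_w_both (h : Arm G S C D c w X d Y E₂ e₂ E₃ e₃) (hE : E ⊆ X) (hF : F ⊆ X)
    (hEF : Apart G E F) (sE : Sees G w E) (sF : Sees G w F) : False :=
  (h.c_sees (hE.trans h.X_sub) (hF.trans h.X_sub) hEF sE sF).elim (h.not_sees_c hE)
    (h.not_sees_c hF)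

lemma X_sub_S (h : Arm G S C D c w X d Y E₂ e₂ E₃ e₃) : X ⊆ S := fun v hv => by
  rw [h.mem_S]; grind

lemma good_X (h : Arm G S C D c w X d Y E₂ e₂ E₃ e₃) : Good G X := by
  refine good_of_classes h.split.conn_left (Sees G w) (Sees G d) ?_ ?_ ?_
  · intro E e hE
    by_contra! hn
    exact h.lift_X h.X_sub_S hE.subset hE (Or.inr hn.1) (Or.inr hn.2) (Finset.Subset.refl _)
  · exact fun E e F f hE hF sE sF hEF => h.not_w_both hE.subset hF.subset hEF sE sF
  · exact fun E e F f hE hF sE sF hEF => h.noClaw.not_sees sE sF h.split.sees_right hEF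
      (h.split.apart.mono hE.subset (Finset.Subset.refl _))
      (h.split.apart.mono hF.subset (Finset.Subset.refl _))

lemma good_insert_d_X (h : Arm G S C D c w X d Y E₂ e₂ E₃ e₃) : Good G (insert d X) := by
  refine good_of_classes (h.split.conn_left.insert h.split.sees_left) (fun E => d ∈ E)
    (fun E => d ∉ E ∧ Sees G w E) ?_ ?_ ?_
  · intro E e hE
    by_contra! hn
    exact h.lift_X (fun v hv => by rw [h.mem_S]; grind) (hE.subset_of_notMem hn.1) hE
      (Or.inr (hn.2 hn.1)) (Or.inl (by simp)) (by grind)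
  · exact fun E e F f hE hF sE sF hEF => hEF.false_of_mem sE sF
  · exact fun E e F f hE hF sE sF hEF => h.not_w_both (hE.subset_of_notMem sE.1)
      (hF.subset_of_notMem sF.1) hEF sE.2 sF.2

lemma good_insert_w_d_X (h : Arm G S C D c w X d Y E₂ e₂ E₃ e₃) :
    Good G (insert w (insert d X)) := by
  refine good_of_classes ((h.split.conn_left.insert h.split.sees_left).insert
    (h.sees_X.mono (by grind))) (fun E => d ∈ E) (fun E => w ∈ E) ?_ ?_ ?_
  · intro E e hE
    by_contra! hn
    have hEX : E ⊆ X := fun a ha => by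
      have := hE.subset ha
      grind
    exact h.lift_X (fun v hv => by rw [h.mem_S]; grind) hEX hE
      (Or.inl (by simp)) (Or.inl (by simp)) (by grind)
  · exact fun E e F f hE hF sE sF hEF => hEF.false_of_mem sE sF
  · exact fun E e F f hE hF sE sF hEF => hEF.false_of_mem sE sF

lemma apart_X (h : Arm G S C D c w X d Y E₂ e₂ E₃ e₃) (hE : E ⊆ Y) : Apart G X E :=
  h.split.apart.mono (Finset.Subset.refl _) hE

/-- Of three apart lobes, one containing `d` absorbs `X` and contradicts the maximality of `X`
(`no_bigger`); if none contains `d`, `no_four` applies. -/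
lemma good_insert_d_Y (h : Arm G S C D c w X d Y E₂ e₂ E₃ e₃) : Good G (insert d Y) := by
  have hUT : insert d Y ⊆ D.erase w := by rw [h.eq_T]; grind
  have key : ∀ {E e}, Lobe G (insert d Y) E e → d ∉ E → Lobe G (D.erase w) E e := by
    intro E e hE hd
    refine hE.lift hUT fun v hv hvU => ?_
    have : v ∈ X := by
      rw [h.eq_T] at hv
      grind
    exact (h.apart_X (hE.subset_of_notMem hd)).not_sees this
  have big : ∀ {E e}, Lobe G (insert d Y) E e → d ∈ E → Lobe G (D.erase w) (E ∪ X) e := by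
    intro E e hE hd
    have hdis := fun v hX hY => h.split.apart.false_of_mem (v := v) hX hY
    have hdX := h.split.notMem_left
    obtain ⟨r, hr, hrE, hre⟩ := hE.rest
    have hem := hE.mem
    have hne := hE.notMem
    refine ⟨Finset.union_subset (hE.subset.trans hUT) h.X_sub,
      ⟨d, by grind⟩, hUT hE.mem, by grind, fun a ha b hb hab => ?_, r, hUT hr, by grind⟩
    rw [h.eq_T] at hb
    have h1 := hE.boundary a
    have h2 := h.split.apart a
    grind
  have fin : ∀ {E e F f H k}, Lobe G (insert d Y) E e → Lobe G (insert d Y) F f →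
      Lobe G (insert d Y) H k → Apart G E F → Apart G E H → Apart G F H → d ∈ E → False := by
    intro E e F f H k hE hF hH hEF hEH hFH hd
    have hdF : d ∉ F := hEF.false_of_mem hd
    have hdH : d ∉ H := hEH.false_of_mem hd
    have hFY := hF.subset_of_notMem hdF
    have hHY := hH.subset_of_notMem hdH
    have hap : ∀ {F}, F ⊆ Y → Apart G E F → Apart G (E ∪ X) F := by
      intro F hF hEF a ha b hb
      rcases Finset.mem_union.1 ha with ha | ha
      · exact hEF a ha b hb
      · exact h.apart_X hF a ha b hb
    exact h.no_bigger (big hE hd) (key hF hdF) (key hH hdH) (by grind) hFY hHY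
      (hap hFY hEF) (hap hHY hEH) hFH
  refine ⟨h.split.conn_right.insert h.split.sees_right,
    fun E₁ e₁ E₂ e₂ E₃ e₃ h₁ h₂ h₃ h₁₂ h₁₃ h₂₃ => ?_⟩
  by_cases d₁ : d ∈ E₁
  · exact fin h₁ h₂ h₃ h₁₂ h₁₃ h₂₃ d₁
  by_cases d₂ : d ∈ E₂
  · exact fin h₂ h₁ h₃ h₁₂.symm h₂₃ h₁₃ d₂
  by_cases d₃ : d ∈ E₃
  · exact fin h₃ h₁ h₂ h₁₃.symm h₂₃.symm h₁₂ d₃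
  exact h.no_four (key h₁ d₁) (key h₂ d₂) (key h₃ d₃) (h₁.subset_of_notMem d₁)
    (h₂.subset_of_notMem d₂) (h₃.subset_of_notMem d₃) h₁₂ h₁₃ h₂₃

/-- The neighbours of `d` in `Y` form a clique. -/
lemma adj_of_d (h : Arm G S C D c w X d Y E₂ e₂ E₃ e₃) {a b : V} (ha : a ∈ Y) (hb : b ∈ Y)
    (hda : G.Adj d a) (hdb : G.Adj d b) : a = b ∨ G.Adj a b := by
  by_contra! hn
  refine h.noClaw.not_sees (A := {a}) (B := {b}) ⟨a, by simp, hda⟩ ⟨b, by simp, hdb⟩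
    h.split.sees_left ?_ (h.split.apart.symm.mono (by simpa using ha) (Finset.Subset.refl _))
    (h.split.apart.symm.mono (by simpa using hb) (Finset.Subset.refl _))
  intro x hx y hy
  simp only [Finset.mem_singleton] at hx hy
  subst hx hy
  exact hn

/-- A part of `Y` seen by `d` and bounded in `Y` by `f` absorbs `d` and `X`. -/
lemma extend (h : Arm G S C D c w X d Y E₂ e₂ E₃ e₃) (hF : F ⊆ Y) (hf : f ∈ Y) (hfF : f ∉ F)
    (hb : ∀ a ∈ F, ∀ b ∈ Y, G.Adj a b → b ∈ F ∨ b = f) (hr : ∃ r ∈ Y, r ∉ F ∧ r ≠ f)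
    (hs : Sees G d F) : Lobe G (D.erase w) (insert d (F ∪ X)) f := by
  obtain ⟨x, hx, hdx⟩ := hs
  obtain ⟨r, hr, hrF, hrf⟩ := hr
  have hdis := fun v hX hY => h.split.apart.false_of_mem (v := v) hX hY
  have hdX := h.split.notMem_left
  have hdY := h.split.notMem_right
  have hYT := h.Y_sub
  refine ⟨by rw [h.eq_T]; grind, by simp, hYT hf, by grind, fun a ha b hbT hab => ?_, r, hYT hr,
    by grind⟩
  rw [h.eq_T] at hbT
  have h1 := h.split.apart a
  have h2 := hb a
  have h3 := fun hbY hab => h.adj_of_d (a := x) (b := b) (hF hx) hbY hdx hab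
  have h4 := hb x hx b
  grind

lemma apart_extend (h : Arm G S C D c w X d Y E₂ e₂ E₃ e₃) (hEF : Apart G E F) (hF : F ⊆ Y)
    (hs : ¬ Sees G d F) : Apart G (insert d (E ∪ X)) F := by
  intro a ha b hb
  have := h.split.notMem_right
  have h1 := fun ha => h.split.apart a ha b (hF hb)
  have h2 := fun ha => hEF a ha b hb
  have h3 : ¬ G.Adj d b := fun hdb => hs ⟨b, hb, hdb⟩
  have := hF hb
  grind

/-- As for `Y + d`, with "seen by `d`" replacing "contains `d`". Absorbing `d` and `X` is possible
because the neighbours of `d` in `Y` form a clique. -/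
lemma good_Y (h : Arm G S C D c w X d Y E₂ e₂ E₃ e₃) : Good G Y := by
  have key : ∀ {E e}, Lobe G Y E e → ¬ Sees G d E → Lobe G (D.erase w) E e := by
    intro E e hE hd
    refine hE.lift h.Y_sub fun v hv hvY => ?_
    rw [h.eq_T] at hv
    simp only [Finset.mem_insert, Finset.mem_union] at hv
    rcases hv with rfl | hv | hv
    · exact hd
    · exact (h.apart_X hE.subset).not_sees hv
    · exact absurd hv hvY
  have fin : ∀ {E e F f H k}, Lobe G Y E e → Lobe G Y F f → Lobe G Y H k → Apart G E F →
      Apart G E H → Apart G F H → Sees G d E → False := by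
    intro E e F f H k hE hF hH hEF hEH hFH hd
    have hns : ∀ {F}, F ⊆ Y → Apart G E F → ¬ Sees G d F := fun hF hEF hs =>
      h.noClaw.not_sees hd hs h.split.sees_left hEF
        (h.split.apart.symm.mono hE.subset (Finset.Subset.refl _))
        (h.split.apart.symm.mono hF (Finset.Subset.refl _))
    have hdF := hns hF.subset hEF
    have hdH := hns hH.subset hEH
    exact h.no_bigger (h.extend hE.subset hE.mem hE.notMem hE.boundary hE.rest hd) (key hF hdF)
      (key hH hdH) (by grind) hF.subset hH.subset (h.apart_extend hEF hF.subset hdF)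
      (h.apart_extend hEH hH.subset hdH) hFH
  refine ⟨h.split.conn_right, fun E₁ e₁ E₂ e₂ E₃ e₃ h₁ h₂ h₃ h₁₂ h₁₃ h₂₃ => ?_⟩
  by_cases d₁ : Sees G d E₁
  · exact fin h₁ h₂ h₃ h₁₂ h₁₃ h₂₃ d₁
  by_cases d₂ : Sees G d E₂
  · exact fin h₂ h₁ h₃ h₁₂.symm h₂₃ h₁₃ d₂
  by_cases d₃ : Sees G d E₃
  · exact fin h₃ h₁ h₂ h₁₃.symm h₂₃.symm h₁₂ d₃
  exact h.no_four (key h₁ d₁) (key h₂ d₂) (key h₃ d₃) h₁.subset h₂.subset h₃.subset h₁₂ h₁₃ h₂₃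

lemma c_sees_Y (h : Arm G S C D c w X d Y E₂ e₂ E₃ e₃) : Sees G c Y :=
  h.sees_leaf.mono h.leaf_sub

/-- No lobe of `C + c + Y` inside `Y` is seen by `c`. -/
lemma not_c_sees_lobe (h : Arm G S C D c w X d Y E₂ e₂ E₃ e₃)
    (hF : Lobe G (insert c (C ∪ Y)) F f) (hFY : F ⊆ Y) (hr : ∃ r ∈ Y, r ∉ F) : ¬ Sees G c F := by
  rintro ⟨a, ha, hca⟩
  have hcF := h.c_notMem (hFY.trans h.Y_sub)
  have hfc : c = f := (hF.boundary a ha c (by simp) hca.symm).resolve_left hcF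
  subst hfc
  have hcY := h.c_notMem h.Y_sub
  have hbd : ∀ a ∈ F, ∀ b ∈ Y, G.Adj a b → b ∈ F := fun a ha b hb hab => by
    have := hF.boundary a ha b (by grind) hab
    grind
  have := h.split.conn_right.subset_of_closed (B := F) ⟨a, hFY ha, ha⟩
    fun a _ haF b hb hab => hbd a haF b hb hab
  grind

end Arm

namespace Arm

variable {S C D X Y E₂ E₃ E F H : Finset V} {c w d e₂ e₃ e f k : V}

/-- Neither lobe is seen by `c`, hence neither by `w`. If `d` sees both, there is a claw with `X`;
if neither, both are lobes of `S` apart from `C`. If `d` sees only one, that lobe absorbs `d` and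
`X`, and the leaf `E₂` is a third lobe contradicting maximality. -/
lemma false_of_lobes_in_Y (h : Arm G S C D c w X d Y E₂ e₂ E₃ e₃)
    (hU : Conn G (insert c (C ∪ Y))) (hE : Lobe G (insert c (C ∪ Y)) E e)
    (hF : Lobe G (insert c (C ∪ Y)) F f) (hEY : E ⊆ Y) (hFY : F ⊆ Y) (hEF : Apart G E F) :
    False := by
  have hUS : insert c (C ∪ Y) ⊆ S := fun v hv => by rw [h.mem_S]; grind
  have hcY := h.c_notMem h.Y_sub
  have hcE : ¬ Sees G c E := h.not_c_sees_lobe hE hEY (by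
    obtain ⟨r, hr⟩ := hF.nonempty
    exact ⟨r, hFY hr, fun hrE => hEF.false_of_mem hrE hr⟩)
  have hcF : ¬ Sees G c F := h.not_c_sees_lobe hF hFY (by
    obtain ⟨r, hr⟩ := hE.nonempty
    exact ⟨r, hEY hr, fun hrF => hEF.false_of_mem hr hrF⟩)
  have lobeS : ∀ {E e}, Lobe G (insert c (C ∪ Y)) E e → E ⊆ Y → ¬ Sees G c E →
      ¬ Sees G d E → Lobe G S E e := by
    intro E e hE hEY hc hd
    refine hE.lift hUS fun v hv hvU => ?_
    rcases (h.mem_S v).1 hv with rfl | hv | rfl | rfl | hv | hv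
    · exact hc
    · exact h.not_sees_C (hEY.trans h.Y_sub) v hv
    · exact fun hs => hc (h.c_sees_of_Y hEY hs)
    · exact hd
    · exact (h.apart_X hEY).not_sees hv
    · grind
  have fin : ∀ {E e F f}, Lobe G (insert c (C ∪ Y)) E e → Lobe G (insert c (C ∪ Y)) F f →
      E ⊆ Y → F ⊆ Y → Apart G E F → ¬ Sees G c E → ¬ Sees G c F → Sees G d E → ¬ Sees G d F →
      False := by
    intro E e F f hE hF hEY hFY hEF hcE hcF hdE hdF
    have hFS := lobeS hF hFY hcF hdF
    have heY : e ∈ Y := by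
      obtain ⟨a, ha, hea⟩ := hE.sees hU
      have h1 := hE.mem
      have h2 := fun heC => (h.apart_C (hEY.trans h.Y_sub) a ha e heC).2 hea.symm
      have h3 : e ≠ c := fun hec => hcE ⟨a, ha, hec ▸ hea⟩
      grind
    have hX' : Lobe G (D.erase w) (insert d (E ∪ X)) e := by
      refine h.extend hEY heY hE.notMem (fun a ha b hb hab => hE.boundary a ha b (by grind) hab)
        ?_ hdE
      obtain ⟨r, hr⟩ := hF.nonempty
      obtain ⟨a, ha, hea⟩ := hE.sees hU
      have h1 := (hEF a ha r hr).2
      have h2 := hea.symm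
      exact ⟨r, hFY hr, fun hrE => hEF.false_of_mem hrE hr, by grind⟩
    have hFc : f ∈ Y := by
      obtain ⟨a, ha, hea⟩ := hF.sees hU
      have h1 := hF.mem
      have h2 := fun heC => (h.apart_C (hFY.trans h.Y_sub) a ha f heC).2 hea.symm
      have h3 : f ≠ c := fun hec => hcF ⟨a, ha, hec ▸ hea⟩
      grind
    have hFT : Lobe G (D.erase w) F f := by
      refine ⟨hFY.trans h.Y_sub, hF.nonempty, h.Y_sub hFc, hF.notMem, fun a ha b hb hab =>
        hFS.boundary a ha b ?_ hab, ?_⟩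
      · rw [h.mem_S]
        rw [h.eq_T] at hb
        grind
      · obtain ⟨r, hr⟩ := hX'.nonempty
        refine ⟨d, ?_, ?_, ?_⟩
        · rw [h.eq_T]; simp
        · have := h.split.notMem_right
          grind
        · have := h.split.notMem_right
          grind
    have hXF := h.apart_extend hEF hFY hdF
    have hcd : ¬ G.Adj d c := by
      intro hdc
      refine h.noClaw.not_sees (A := X) (B := E) (C := {c}) h.split.sees_left hdE
        ⟨c, by simp, hdc⟩ (h.apart_X hEY) (h.apart_c h.X_sub h.not_sees_X)
        (h.apart_c (hEY.trans h.Y_sub) hcE)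
    have hcX' : ¬ Sees G c (insert d (E ∪ X)) := by
      rintro ⟨a, ha, hca⟩
      have h1 := hca.symm
      have h2 := fun ha => hcE ⟨a, ha, hca⟩
      have h3 := fun ha => h.not_sees_X ⟨a, ha, hca⟩
      grind
    obtain ⟨κ, hκ, hcκ⟩ := h.sees_leaf
    -- A leaf lies inside a lobe or apart from it; `c` sees `E₂` but not the enlarged lobe.
    have hap1 : Apart G E₂ (insert d (E ∪ X)) :=
      (h.leaf.subset_or_apart h.noClaw h.conn hX').resolve_left
        fun hsub => hcX' ⟨κ, hsub hκ, hcκ⟩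
    have hap2 : Apart G E₂ F :=
      (h.leaf.subset_or_apart h.noClaw h.conn hFT).resolve_left fun hsub => hcF ⟨κ, hsub hκ, hcκ⟩
    exact h.no_bigger hX' h.leaf.toLobe hFT (by grind) h.leaf_sub hFY hap1.symm hXF hap2
  by_cases hdE : Sees G d E
  · by_cases hdF : Sees G d F
    · exact h.noClaw.not_sees h.split.sees_left hdE hdF (h.apart_X hEY) (h.apart_X hFY) hEF
    · exact fin hE hF hEY hFY hEF hcE hcF hdE hdF
  · by_cases hdF : Sees G d F
    · exact fin hF hE hFY hEY hEF.symm hcF hcE hdF hdE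
    · exact h.good.2 _ _ _ _ _ _ (lobeS hE hEY hcE hdE) (lobeS hF hFY hcF hdF) h.cut.lobe hEF
        (h.apart_C (hEY.trans h.Y_sub)) (h.apart_C (hFY.trans h.Y_sub))

lemma good_insert_c_C_Y (h : Arm G S C D c w X d Y E₂ e₂ E₃ e₃) :
    Good G (insert c (C ∪ Y)) := by
  have hU : Conn G (insert c (C ∪ Y)) := by
    rw [← Finset.insert_union]
    obtain ⟨y, hy, hcy⟩ := h.c_sees_Y
    exact (h.cut.conn_left.insert h.cut.sees_left).union h.split.conn_right
      ⟨c, by simp, y, hy, hcy⟩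
  have hUS : insert c (C ∪ Y) ⊆ S := fun v hv => by rw [h.mem_S]; grind
  have hYC := h.apart_C h.Y_sub
  have hcY := h.c_notMem h.Y_sub
  have hC : Lobe G (insert c (C ∪ Y)) C c := by
    obtain ⟨y, hy⟩ := h.split.conn_right.1
    refine ⟨by grind, h.cut.conn_left.1, by simp, h.cut.notMem_left, fun a ha b hb hab => ?_, y,
      by grind, fun hyC => hYC.false_of_mem hy hyC, by grind⟩
    have := fun hbY => (hYC b hbY a ha).2 hab.symm
    grind
  refine good_of_leaves hU fun F₁ f₁ F₂ f₂ F₃ f₃ h₁ h₂ h₃ h₁₂ h₁₃ h₂₃ => ?_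
  have key : ∀ E e, Leaf G (insert c (C ∪ Y)) E e → (E ⊆ C ∧ Lobe G S E e) ∨ E ⊆ Y := by
    intro E e hE
    have hc := hE.notMem_of_lobe hU hC
    rcases hE.subset_or_apart h.noClaw hU hC with h1 | h1
    · refine Or.inl ⟨h1, hE.toLobe.lift hUS fun v hv hv' => ?_⟩
      have : v ∈ D := by
        have := h.cut.eq
        grind
      exact (h.cut.apart.symm.mono (Finset.Subset.refl _) h1).not_sees this
    · right
      intro a ha
      have := hE.subset ha
      have := fun haC : a ∈ C => h1.false_of_mem ha haC
      grind
  have fin : ∀ {E e F f}, (E ⊆ C ∧ Lobe G S E e) → (F ⊆ C ∧ Lobe G S F f) → Apart G E F →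
      False := by
    intro E e F f hE hF hEF
    exact h.good.2 _ _ _ _ _ _ hE.2 hF.2 h.cut.symm.lobe hEF
      (h.cut.apart.mono hE.1 (Finset.Subset.refl _)) (h.cut.apart.mono hF.1 (Finset.Subset.refl _))
  rcases key _ _ h₁ with a | a <;> rcases key _ _ h₂ with b | b <;>
    rcases key _ _ h₃ with c | c
  · exact fin a b h₁₂
  · exact fin a b h₁₂
  · exact fin a c h₁₃
  · exact h.false_of_lobes_in_Y hU h₂.toLobe h₃.toLobe b c h₂₃
  · exact fin b c h₂₃
  · exact h.false_of_lobes_in_Y hU h₁.toLobe h₃.toLobe a c h₁₃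
  · exact h.false_of_lobes_in_Y hU h₁.toLobe h₂.toLobe a b h₁₂
  · exact h.false_of_lobes_in_Y hU h₁.toLobe h₂.toLobe a b h₁₂

end Arm

/-! ### Λ-factors of good sets, by induction on size. -/

/-- `S` has a partition into triples that carry 3-vertex paths. -/
inductive Fac (G : SimpleGraph V) : Finset V → Prop
  | triple (a b c : V) : a ≠ c → G.Adj a b → G.Adj b c → Fac G {a, b, c}
  | union (A B : Finset V) : Disjoint A B → Fac G A → Fac G B → Fac G (A ∪ B)

lemma Fac.of_eq {S A B : Finset V} (hA : Fac G A) (hB : Fac G B) (hd : ∀ v ∈ A, v ∉ B)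
    (h : ∀ v, v ∈ S ↔ v ∈ A ∨ v ∈ B) : Fac G S := by
  have : S = A ∪ B := by ext v; simp [h]
  rw [this]
  exact Fac.union _ _ (Finset.disjoint_left.2 hd) hA hB

lemma Apart.disjoint {A B : Finset V} (h : Apart G A B) : Disjoint A B :=
  Finset.disjoint_left.2 fun _ hA hB => h.false_of_mem hA hB

lemma Split.card {S C D : Finset V} {c : V} (h : Split G S c C D) :
    S.card = C.card + D.card + 1 := by
  rw [h.eq, Finset.card_insert_of_notMem, Finset.card_union_of_disjoint h.apart.disjoint]
  simp [h.notMem_left, h.notMem_right]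

/-- The inductive step when `S` has a cut vertex. -/
lemma Split.fac (hG : NoClaw G) {S : Finset V} (hS : Good G S)
    (h3 : S.card % 3 = 0) (ih : ∀ T : Finset V, T.card < S.card → T.card % 3 = 0 → Good G T → Fac G T)
    {c : V} {C D : Finset V} (h : Split G S c C D) : Fac G S := by
  have easy : ∀ {c C D}, Split G S c C D → C.card % 3 = 0 → Fac G S := by
    intro c C D h h0
    have hcard := h.card
    have h1 : (insert c D).card = D.card + 1 := Finset.card_insert_of_notMem h.notMem_right
    have hC := Finset.card_pos.2 h.conn_left.1
    have hD := Finset.card_pos.2 h.conn_right.1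
    refine Fac.of_eq (ih C (by omega) h0 (h.good_left hG hS))
      (ih (insert c D) (by omega) (by omega) (h.symm.good_insert hS)) ?_ ?_
    · have := h.notMem_left
      have := fun v => h.apart.false_of_mem (v := v)
      grind
    · rw [h.eq]
      grind
  by_contra hno
  -- The two sides have total size 2 mod 3, and residue 0 is already settled, so both residues are 1
  -- at every cut vertex.
  have hmod : ∀ w A B, Split G S w A B → A.card % 3 = 1 := by
    intro w A B h
    have hcard := h.card
    have h1 : A.card % 3 ≠ 0 := fun h0 => hno (easy h h0)
    have h2 : B.card % 3 ≠ 0 := fun h0 => hno (easy h.symm h0)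
    omega
  have main : ∀ {c C D}, Split G S c C D → 2 ≤ D.card → False := by
    intro c C D h hD
    obtain ⟨w, hw, hcw, hconn⟩ := h.exists_conn_erase hG hS hD hmod
    have hC1 := hmod _ _ _ h
    have hD1 := hmod _ _ _ h.symm
    have hcard := h.card
    have hwC : w ∉ C := fun hwC => h.apart.false_of_mem hwC hw
    have hcl : (insert w (insert c C)).card = C.card + 2 := by
      rw [Finset.card_insert_of_notMem, Finset.card_insert_of_notMem h.notMem_left]
      have := hcw.ne
      grind
    have hDw : (D.erase w).card = D.card - 1 := Finset.card_erase_of_mem hw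
    have hleft : Fac G (insert w (insert c C)) :=
      ih _ (by omega) (by omega) (h.good_insert_insert hG hS hw hcw)
    have hdis := fun v => h.apart.false_of_mem (v := v)
    have hcD := h.notMem_right
    have hcC := h.notMem_left
    have hSeq := h.eq
    by_cases hgood : Good G (D.erase w)
    · refine hno (Fac.of_eq hleft (ih _ (by omega) (by omega) hgood) ?_ ?_)
      · grind
      · grind
    have hb : Branch G S C D c w := ⟨hG, hS, h, hw, hcw, hconn⟩
    obtain ⟨X, d, Y, E₂, e₂, E₃, e₃, ha⟩ := hb.exists_arm hgood
    have hXY := ha.split.card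
    have hX := Finset.card_pos.2 ha.split.conn_left.1
    have hY := Finset.card_pos.2 ha.split.conn_right.1
    have hdX := ha.split.notMem_left
    have hdY := ha.split.notMem_right
    obtain ⟨hdw, hwX, hwY⟩ := ha.ne_w
    have hdisXY := fun v => ha.split.apart.false_of_mem (v := v)
    have hcX := ha.c_notMem ha.X_sub
    have hcY := ha.c_notMem ha.Y_sub
    have hT : ∀ v, v ∈ insert d (X ∪ Y) → v ∈ D ∧ v ≠ w := fun v hv => by
      rw [← ha.eq_T] at hv
      grind
    have hmem := ha.mem_S
    have hcdY : (insert d Y).card = Y.card + 1 := Finset.card_insert_of_notMem hdY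
    have hcdX : (insert d X).card = X.card + 1 := Finset.card_insert_of_notMem hdX
    have hcwX : (insert w (insert d X)).card = X.card + 2 := by
      rw [Finset.card_insert_of_notMem, hcdX]
      grind
    have hCY : (insert c (C ∪ Y)).card = C.card + Y.card + 1 := by
      rw [Finset.card_insert_of_notMem (by grind),
        Finset.card_union_of_disjoint (ha.apart_C ha.Y_sub).symm.disjoint]
    -- Here `|X| + |Y| + 1` is 0 mod 3. Residues 0 and 2 divide `D - w` at `d`, keeping `C + c + w`;
    -- residue 1 instead uses `X + d + w` and `C + c + Y`.
    obtain hm | hm | hm : X.card % 3 = 0 ∨ X.card % 3 = 1 ∨ X.card % 3 = 2 := by omega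
    · have hr : Fac G (X ∪ insert d Y) :=
        Fac.of_eq (ih X (by omega) hm ha.good_X)
          (ih (insert d Y) (by omega) (by omega) ha.good_insert_d_Y) (by grind) (by grind)
      refine hno (Fac.of_eq hleft hr ?_ ?_)
      · grind
      · grind
    · refine hno (Fac.of_eq
        (ih (insert w (insert d X)) (by omega) (by omega) ha.good_insert_w_d_X)
        (ih (insert c (C ∪ Y)) (by omega) (by omega) ha.good_insert_c_C_Y) ?_ ?_)
      · grind
      · grind
    · have hr : Fac G (insert d X ∪ Y) :=
        Fac.of_eq (ih (insert d X) (by omega) (by omega) ha.good_insert_d_X)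
          (ih Y (by omega) (by omega) ha.good_Y) (by grind) (by grind)
      refine hno (Fac.of_eq hleft hr ?_ ?_)
      · grind
      · grind
  have hC1 := hmod _ _ _ h
  have hD1 := hmod _ _ _ h.symm
  by_cases hD : 2 ≤ D.card
  · exact main h hD
  by_cases hC : 2 ≤ C.card
  · exact main h.symm hC
  obtain ⟨a, rfl⟩ := Finset.card_eq_one.1 (show C.card = 1 by omega)
  obtain ⟨b, rfl⟩ := Finset.card_eq_one.1 (show D.card = 1 by omega)
  obtain ⟨a', ha', hca⟩ := h.sees_left
  obtain ⟨b', hb', hcb⟩ := h.sees_right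
  simp only [Finset.mem_singleton] at ha' hb'
  subst ha' hb'
  have : S = {a', c, b'} := by
    rw [h.eq]
    grind
  rw [this] at hno
  exact hno (Fac.triple _ _ _ (h.apart a' (by simp) b' (by simp)).1 hca.symm hcb)

/-- A connected claw-free set with at most two end-blocks, whose size is divisible by three, has a
partition into 3-vertex paths. -/
theorem Good.fac (hG : NoClaw G) {S : Finset V} (hS : Good G S) (h3 : S.card % 3 = 0) :
    Fac G S := by
  induction hn : S.card using Nat.strong_induction_on generalizing S with
  | _ n ih =>
  subst hn
  have ih : ∀ T : Finset V, T.card < S.card → T.card % 3 = 0 → Good G T → Fac G T :=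
    fun T hT h0 hg => ih _ hT hg h0 rfl
  have hpos := Finset.card_pos.2 hS.1.1
  by_cases hlobe : ∃ X f, Lobe G S X f
  · obtain ⟨X, f, hX⟩ := hlobe
    exact (hX.split hG hS.1).fac hG hS h3 ih
  push Not at hlobe
  have hne : ∀ y ∈ S, (S.erase y).Nonempty := fun y hy => by
    rw [← Finset.card_pos, Finset.card_erase_of_mem hy]
    omega
  have hconn : ∀ y ∈ S, Conn G (S.erase y) := fun y hy =>
    conn_erase_of_no_lobe hy (hne y hy) fun X => hlobe X y
  by_cases hlobe2 : ∃ y ∈ S, ∃ X f, Lobe G (S.erase y) X f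
  · obtain ⟨y, hy, C, d, hX⟩ := hlobe2
    have h := (hX.split hG (hconn y hy)).twoCut hlobe hy
    -- Up to exchanging the sides, the residues of `|C|`, `|D|` are `(0, 1)` or `(2, 2)`: `D` takes
    -- both cut vertices, or each side takes one.
    have main : ∀ {C D}, TwoCut G S y d C D → D.card % 3 ≠ 0 → Fac G S := by
      intro C D h hD0
      have hcap := fun v => h.apart.false_of_mem (v := v)
      have hyd := h.ne
      have hyC := h.y_left
      have hyD := h.y_right
      have hdC := h.d_left
      have hdD := h.d_right
      have hSeq := h.eq
      have hC := Finset.card_pos.2 h.conn_left.1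
      have hD := Finset.card_pos.2 h.conn_right.1
      have hcard : S.card = C.card + D.card + 2 := by
        rw [hSeq, Finset.card_insert_of_notMem (by grind), Finset.card_insert_of_notMem (by grind),
          Finset.card_union_of_disjoint h.apart.disjoint]
      by_cases h0 : C.card % 3 = 0
      · have hc : (insert y (insert d D)).card = D.card + 2 := by
          rw [Finset.card_insert_of_notMem (by grind), Finset.card_insert_of_notMem (by grind)]
        exact Fac.of_eq (ih C (by omega) h0 (h.good_left hG))
          (ih (insert y (insert d D)) (by omega) (by omega) h.symm.good_insert_insert)
          (by grind) (by grind)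
      · have hc : (insert y C).card = C.card + 1 := Finset.card_insert_of_notMem hyC
        have hd : (insert d D).card = D.card + 1 := Finset.card_insert_of_notMem hdD
        exact Fac.of_eq (ih (insert y C) (by omega) (by omega) (h.good_insert hG))
          (ih (insert d D) (by omega) (by omega) (h.symm.swap.good_insert hG))
          (by grind) (by grind)
    by_cases h0 : ((S.erase y \ C).erase d).card % 3 = 0
    · refine main h.symm fun h1 => ?_
      have := (hX.split hG (hconn y hy)).card
      rw [Finset.card_erase_of_mem hy] at this
      omega
    · exact main h h0
  push Not at hlobe2
  obtain ⟨y, hy⟩ := hS.1.1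
  obtain ⟨y', hy', v, hv, hvy, hyv⟩ := hS.1.exists_adj (A := {y}) (by simpa using hy) (by simp) (by
    obtain ⟨r, hr⟩ := hne y hy
    exact ⟨r, by grind, by grind⟩)
  obtain rfl := Finset.mem_singleton.1 hy'
  have hyv' := hyv.ne
  have hvSy : v ∈ S.erase y' := by grind
  have hc2 : ((S.erase y').erase v).card = S.card - 2 := by
    rw [Finset.card_erase_of_mem hvSy, Finset.card_erase_of_mem hy]
    omega
  have hne2 : ((S.erase y').erase v).Nonempty := by
    rw [← Finset.card_pos]
    omega
  have hconn2 : Conn G ((S.erase y').erase v) :=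
    conn_erase_of_no_lobe hvSy hne2 fun X => hlobe2 y' hy X v
  by_cases hlobe3 : ∃ X d, Lobe G ((S.erase y').erase v) X d
  · obtain ⟨C, d, hX⟩ := hlobe3
    have h := (hX.split hG hconn2).threeCut hlobe2 hy hv hyv
    -- Up to exchanging the sides, the residues are `(0, 0)` or `(1, 2)`: `C` takes all three cut
    -- vertices, or `C` takes the adjacent pair and `D` takes `d`.
    have main : ∀ {C D}, ThreeCut G S y' v d C D → D.card % 3 ≠ 1 → Fac G S := by
      intro C D h hD0
      have hcap := fun v => h.apart.false_of_mem (v := v)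
      have hd := h.ne_d
      have hl := h.left
      have hr := h.right
      have hSeq := h.eq
      have hC := Finset.card_pos.2 h.conn_left.1
      have hD := Finset.card_pos.2 h.conn_right.1
      have hcard : S.card = C.card + D.card + 3 := by
        rw [hSeq, Finset.card_insert_of_notMem (by grind), Finset.card_insert_of_notMem (by grind),
          Finset.card_insert_of_notMem (by grind), Finset.card_union_of_disjoint h.apart.disjoint]
      by_cases h0 : D.card % 3 = 0
      · have hc : (insert y' (insert v (insert d C))).card = C.card + 3 := by
          rw [Finset.card_insert_of_notMem (by grind), Finset.card_insert_of_notMem (by grind),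
            Finset.card_insert_of_notMem (by grind)]
        exact Fac.of_eq (ih _ (by omega) (by omega) h.good_insert_yvd)
          (ih D (by omega) h0 (h.symm.good_left hG)) (by grind) (by grind)
      · have hc : (insert y' (insert v C)).card = C.card + 2 := by
          rw [Finset.card_insert_of_notMem (by grind), Finset.card_insert_of_notMem (by grind)]
        have hd : (insert d D).card = D.card + 1 := Finset.card_insert_of_notMem (by grind)
        exact Fac.of_eq (ih _ (by omega) (by omega) h.good_insert_yv)
          (ih _ (by omega) (by omega) (h.symm.good_insert_d hG)) (by grind) (by grind)
    by_cases h0 : ((((S.erase y').erase v) \ C).erase d).card % 3 = 1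
    · refine main h.symm fun h1 => ?_
      have := (hX.split hG hconn2).card
      omega
    · exact main h h0
  push Not at hlobe3
  obtain ⟨v', hv', w, hw, hwv, hvw⟩ := (hconn y' hy).exists_adj (A := {v}) (by simpa using hvSy)
    (by simp) (by
      obtain ⟨r, hr⟩ := hne2
      exact ⟨r, by grind, by grind⟩)
  obtain rfl := Finset.mem_singleton.1 hv'
  have hwy : w ≠ y' := by grind
  -- `S - y' - v'` has no cut vertex, so removing `w` too leaves a good set (or nothing), and the
  -- path `y' v' w` splits off.
  have ht := Fac.triple _ _ _ hwy.symm hyv hvw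
  have hw2 : w ∈ (S.erase y').erase v' := by grind
  by_cases hne3 : (((S.erase y').erase v').erase w).Nonempty
  · have hc3 : (((S.erase y').erase v').erase w).card = S.card - 3 := by
      rw [Finset.card_erase_of_mem hw2, hc2]
      omega
    have hg := Good.erase_of_no_lobe hG hlobe3
      (conn_erase_of_no_lobe hw2 hne3 fun X => hlobe3 X w)
    exact Fac.of_eq ht (ih _ (by omega) (by omega) hg) (by grind) (by grind)
  · have : S = {y', v', w} := by
      rw [Finset.not_nonempty_iff_eq_empty] at hne3
      ext a
      have : a ∉ ((S.erase y').erase v').erase w := by simp [hne3]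
      grind
    rwa [this]

/-! ### Choosing `z` in a leaf of the graph without `x` and `y`. -/

lemma Lobe.apart_cut {T E F : Finset V} {e : V} (hT : Conn G T) (h : Lobe G T E e)
    (hEF : Apart G E F) : e ∉ F := by
  obtain ⟨a, ha, hea⟩ := h.sees hT
  exact fun he => (hEF a ha e he).2 hea.symm

lemma Lobe.conn_sdiff (hG : NoClaw G) {T E : Finset V} {e : V} (hT : Conn G T)
    (h : Lobe G T E e) : Conn G (T \ E) := by
  have hs := h.split hG hT
  have : T \ E = insert e ((T \ E).erase e) := by
    rw [Finset.insert_erase]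
    have := h.mem
    have := h.notMem
    grind
  rw [this]
  exact hs.conn_right.insert hs.sees_right

/-- The setting of a 3-connected claw-free graph in which the adjacent vertices `x`, `y` have been
deleted, leaving `S`. -/
structure EdgeDeleted (G : SimpleGraph V) (x y : V) (S : Finset V) : Prop where
  noClaw : NoClaw G
  ne : x ≠ y
  mem : ∀ v, v ∈ S ↔ v ≠ x ∧ v ≠ y
  separate : ∀ (E : Finset V) (p q : V), E.Nonempty → p ∉ E → q ∉ E →
    (∀ a ∈ E, ∀ b, G.Adj a b → b ∈ E ∨ b = p ∨ b = q) → ∀ v, v ∈ E ∨ v = p ∨ v = q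
  conn : Conn G S

/-- The configuration obstructing the deletion of `z` from the leaf `E` of `S`. -/
structure Obstruction (G : SimpleGraph V) (x y : V) (S E : Finset V) (z : V) (F₁ : Finset V)
    (f₁ : V) (F₂ : Finset V) (f₂ : V) (F₃ : Finset V) (f₃ : V) : Prop where
  lobe₁ : Lobe G (S.erase z) F₁ f₁
  lobe₂ : Lobe G (S.erase z) F₂ f₂
  lobe₃ : Lobe G (S.erase z) F₃ f₃
  apart₁₂ : Apart G F₁ F₂
  apart₁₃ : Apart G F₁ F₃
  apart₂₃ : Apart G F₂ F₃
  x₁ : Sees G x F₁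
  z₁ : Sees G z F₁
  y₂ : Sees G y F₂
  z₂ : Sees G z F₂
  x₃ : Sees G x F₃
  y₃ : Sees G y F₃
  apart : Apart G E F₃
  sub₁ : F₁ ⊆ E
  sub₂ : F₂ ⊆ E

namespace EdgeDeleted

variable {x y z : V} {S E F : Finset V} {e f : V}

/-- At least two of `x`, `y`, `z` see the lobe; otherwise `f` and the remaining one would separate
it in a 3-connected graph. -/
lemma sees_of_lobe (h : EdgeDeleted G x y S) (hz : z ∈ S) (hF : Lobe G (S.erase z) F f) :
    (Sees G x F ∨ Sees G y F) ∧ (Sees G x F ∨ Sees G z F) ∧ (Sees G y F ∨ Sees G z F) := by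
  have hzS := (h.mem z).1 hz
  obtain ⟨r, hr, hrF, hrf⟩ := hF.rest
  have hrS := (h.mem r).1 (Finset.mem_of_mem_erase hr)
  have hsub : ∀ a ∈ F, a ≠ x ∧ a ≠ y ∧ a ≠ z := fun a ha => by
    have := hF.subset ha
    have := h.mem a
    grind
  have key : ∀ u, u ∉ F → r ≠ u → (∀ a ∈ F, ∀ b, G.Adj a b → b = x ∨ b = y ∨ b = z → b = u) →
      False := by
    intro u huF hru hb
    have := h.separate F f u hF.nonempty hF.notMem huF (fun a ha b hab => by
      have h1 := hb a ha b hab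
      have h2 := h.mem b
      have h3 := hF.boundary a ha b
      grind) r
    grind
  refine ⟨?_, ?_, ?_⟩
  · by_contra! hn
    refine key z (by grind) (by grind) fun a ha b hab hb => ?_
    rcases hb with rfl | rfl | rfl
    · exact absurd ⟨a, ha, hab.symm⟩ hn.1
    · exact absurd ⟨a, ha, hab.symm⟩ hn.2
    · rfl
  · by_contra! hn
    refine key y (by grind) (by grind) fun a ha b hab hb => ?_
    rcases hb with rfl | rfl | rfl
    · exact absurd ⟨a, ha, hab.symm⟩ hn.1
    · rfl
    · exact absurd ⟨a, ha, hab.symm⟩ hn.2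
  · by_contra! hn
    refine key x (by grind) (by grind) fun a ha b hab hb => ?_
    rcases hb with rfl | rfl | rfl
    · rfl
    · exact absurd ⟨a, ha, hab.symm⟩ hn.1
    · exact absurd ⟨a, ha, hab.symm⟩ hn.2

lemma conn_erase (h : EdgeDeleted G x y S) (hE : Leaf G S E e) (hz : z ∈ E) :
    Conn G (S.erase z) :=
  conn_erase_of_no_lobe (hE.subset hz)
    ⟨e, Finset.mem_erase.2 ⟨fun h => hE.notMem (h ▸ hz), hE.mem⟩⟩
    fun _ hX => hE.notMem_of_lobe h.conn hX hz

/-- Two lobes of `S - z` seen by `z` lie inside the leaf `E`. -/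
lemma lobe_subset (h : EdgeDeleted G x y S) (hE : Leaf G S E e) (hz : z ∈ E)
    {F₁ F₂ F₃ : Finset V} {f₁ f₂ : V} (h₁ : Lobe G (S.erase z) F₁ f₁)
    (h₂ : Lobe G (S.erase z) F₂ f₂) (s₁ : Sees G z F₁) (s₂ : Sees G z F₂)
    (h₁₂ : Apart G F₁ F₂) (h₂₃ : Apart G F₂ F₃) (hE3 : Apart G E F₃) (hne : F₃.Nonempty)
    (hF3 : F₃ ⊆ S.erase z) : F₂ ⊆ E := by
  have hT := h.conn_erase hE hz
  have hzS := hE.subset hz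
  have heT : e ∈ S.erase z := Finset.mem_erase.2 ⟨fun h => hE.notMem (h ▸ hz), hE.mem⟩
  -- If `e ∈ F₂`, a proper part of the connected set `S - z` is closed: what lies outside `E` and
  -- `F₂` when `f₂ ∈ E`, and `E` without `F₂` otherwise. `F₃` and `F₁` respectively show that it is
  -- nonempty.
  have heF : e ∉ F₂ := by
    intro heF
    by_cases hf : f₂ ∈ E
    · have hcl := hT.subset_of_closed (B := (S \ E) \ F₂) (by
        obtain ⟨r, hr⟩ := hne
        refine ⟨r, hF3 hr, ?_⟩
        have h1 := fun hrE => hE3.false_of_mem (v := r) hrE hr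
        have h2 := fun hrE => h₂₃.false_of_mem (v := r) hrE hr
        have := hF3 hr
        grind) (by
        intro a haT ha b hb hab
        have h1 := fun hbF => h₂.boundary b hbF a haT hab.symm
        have h2 := fun hbE => hE.boundary b hbE a (by grind) hab.symm
        grind)
      have := hcl heT
      grind
    · have hcl := hT.subset_of_closed (B := E \ F₂) (by
        obtain ⟨g, hg, hzg⟩ := s₁
        have h1 := hE.boundary z hz g (Finset.mem_of_mem_erase (h₁.subset hg)) hzg
        have h2 := fun hg' => h₁₂.false_of_mem (v := g) hg hg'
        exact ⟨g, h₁.subset hg, by grind⟩) (by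
        intro a haT ha b hb hab
        have h1 := fun hbF => h₂.boundary b hbF a haT hab.symm
        have h2 := hE.boundary a (by grind) b (by grind) hab
        grind)
      have := hcl heT
      grind
  obtain ⟨g, hg, hzg⟩ := s₂
  refine (h₂.conn h.noClaw hT).subset_of_closed ⟨g, hg, ?_⟩ ?_
  · have := hE.boundary z hz g (Finset.mem_of_mem_erase (h₂.subset hg)) hzg
    grind
  · intro a ha haE b hb hab
    have := hE.boundary a haE b (Finset.mem_of_mem_erase (h₂.subset hb)) hab
    grind

/-- Double counting: each of three apart lobes is seen by at least two of `x`, `y`, `z`, and each of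
these sees at most two lobes. So every lobe is missed by exactly one vertex, and vice versa. The
lobe missed by `z` is a lobe of `S`, hence apart from the leaf `E`. -/
lemma exists_obstruction (h : EdgeDeleted G x y S) (hE : Leaf G S E e) (hz : z ∈ E)
    (hbad : ¬ Good G (S.erase z)) :
    ∃ F₁ f₁ F₂ f₂ F₃ f₃, Obstruction G x y S E z F₁ f₁ F₂ f₂ F₃ f₃ := by
  have hzS := hE.subset hz
  have hT := h.conn_erase hE hz
  have key : ∀ {A a B b C c}, Lobe G (S.erase z) A a → Lobe G (S.erase z) B b →
      Lobe G (S.erase z) C c → Apart G A B → Apart G A C → Apart G B C → ¬ Sees G z C →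
      ∃ F₁ f₁ F₂ f₂ F₃ f₃, Obstruction G x y S E z F₁ f₁ F₂ f₂ F₃ f₃ := by
    intro A a B b C c hA hB hC hAB hAC hBC hzC
    have sA := h.sees_of_lobe hzS hA
    have sB := h.sees_of_lobe hzS hB
    have sC := h.sees_of_lobe hzS hC
    have nx := fun s₁ s₂ s₃ => h.noClaw.not_sees (v := x) s₁ s₂ s₃ hAB hAC hBC
    have ny := fun s₁ s₂ s₃ => h.noClaw.not_sees (v := y) s₁ s₂ s₃ hAB hAC hBC
    have hCS : Lobe G S C c := hC.lift (Finset.erase_subset _ _) fun v hv hv' => by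
      have : v = z := by grind
      rwa [this]
    have hEC : Apart G E C := (hE.subset_or_apart h.noClaw h.conn hCS).resolve_left
      fun hsub => by
        have := hC.subset (hsub hz)
        grind
    have hxC := sC.2.1.resolve_right hzC
    have hyC := sC.2.2.resolve_right hzC
    have hzA : Sees G z A := by
      by_contra hzA
      exact sB.1.elim (fun s => nx (sA.2.1.resolve_right hzA) s hxC)
        fun s => ny (sA.2.2.resolve_right hzA) s hyC
    have hzB : Sees G z B := by
      by_contra hzB
      exact sA.1.elim (fun s => nx s (sB.2.1.resolve_right hzB) hxC)
        fun s => ny s (sB.2.2.resolve_right hzB) hyC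
    have hAE := h.lobe_subset hE hz hB hA hzB hzA hAB.symm hAC hEC hC.nonempty hC.subset
    have hBE := h.lobe_subset hE hz hA hB hzA hzB hAB hBC hEC hC.nonempty hC.subset
    by_cases hxA : Sees G x A
    · have hyB := sB.1.resolve_left fun s => nx hxA s hxC
      exact ⟨A, a, B, b, C, c, hA, hB, hC, hAB, hAC, hBC, hxA, hzA, hyB, hzB, hxC, hyC, hEC, hAE,
        hBE⟩
    · have hyA := sA.1.resolve_left hxA
      have hxB := sB.1.resolve_right fun s => ny hyA s hyC
      exact ⟨B, b, A, a, C, c, hB, hA, hC, hAB.symm, hBC, hAC, hxB, hzB, hyA, hzA, hxC, hyC, hEC,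
        hBE, hAE⟩
  by_contra hno
  refine hbad ⟨hT, fun A a B b C c hA hB hC hAB hAC hBC => ?_⟩
  by_cases zC : Sees G z C
  · by_cases zB : Sees G z B
    · by_cases zA : Sees G z A
      · exact h.noClaw.not_sees zA zB zC hAB hAC hBC
      · exact hno (key hB hC hA hBC hAB.symm hAC.symm zA)
    · exact hno (key hA hC hB hAC hAB hBC.symm zB)
  · exact hno (key hA hB hC hAB hAC hBC zC)

/-- The neighbours in `E` of a vertex that also sees a set apart from `E` form a clique. -/
lemma _root_.LambdaPacking.NoClaw.eq_or_adj (hG : NoClaw G) {v a b : V} {E F : Finset V}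
    (hEF : Apart G E F) (hs : Sees G v F) (ha : a ∈ E) (hb : b ∈ E) (hva : G.Adj v a)
    (hvb : G.Adj v b) : a = b ∨ G.Adj a b := by
  by_contra! hn
  refine hG.not_sees (A := {a}) (B := {b}) ⟨a, by simp, hva⟩ ⟨b, by simp, hvb⟩ hs ?_
    (hEF.mono (by simpa using ha) (Finset.Subset.refl _))
    (hEF.mono (by simpa using hb) (Finset.Subset.refl _))
  intro x hx y hy
  simp only [Finset.mem_singleton] at hx hy
  subst hx hy
  exact hn

/-- The new vertex is a neighbour `p` of `y` in `F₂`. If it were bad too, comparing the two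
obstructions would force the lobe `E₁` of `S - p` to swallow everything outside `F₁`, `F₂` and `z`,
including `E₃`. -/
lemma exists_good_of_obstruction (h : EdgeDeleted G x y S) (hE : Leaf G S E e) (hz : z ∈ E)
    (hyz : G.Adj y z) {F₁ F₂ F₃ : Finset V} {f₁ f₂ f₃ : V}
    (o : Obstruction G x y S E z F₁ f₁ F₂ f₂ F₃ f₃) :
    ∃ p ∈ E, G.Adj y p ∧ Good G (S.erase p) := by
  by_contra! hno
  obtain ⟨p, hp, hyp⟩ := o.y₂
  have hpE := o.sub₂ hp
  obtain ⟨E₁, e₁, E₂, e₂, E₃, e₃, o'⟩ := h.exists_obstruction hE hpE (hno p hpE hyp)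
  have hT := h.conn_erase hE hz
  have hT' := h.conn_erase hE hpE
  have hpz : p ≠ z := by
    have := o.lobe₂.subset hp
    grind
  have hzS := hE.subset hz
  -- The neighbours of `y` in `E` form a clique, and one of them lies in `E₂`, which is apart from
  -- `E₁`.
  have hzE₁ : z ∉ E₁ := by
    intro hzE
    obtain ⟨q, hq, hyq⟩ := o'.y₂
    have h1 := h.noClaw.eq_or_adj o.apart o.y₃ hz (o'.sub₂ hq) hyz hyq
    have h2 := o'.apart₁₂ z hzE q hq
    grind
  have hf₁F₂ := o.lobe₁.apart_cut hT o.apart₁₂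
  have hf₁F₃ := o.lobe₁.apart_cut hT o.apart₁₃
  have hf₂F₁ := o.lobe₂.apart_cut hT o.apart₁₂.symm
  have hE₁conn := o'.lobe₁.conn h.noClaw hT'
  have hF₁conn := o.lobe₁.conn h.noClaw hT
  have hE₁T : ∀ a ∈ E₁, a ∈ S.erase z := fun a ha => by
    have := o'.lobe₁.subset ha
    grind
  have hF₁T' : ∀ a ∈ F₁, a ∈ S.erase p := fun a ha => by
    have := o.lobe₁.subset ha
    have := fun hap : a = p => o.apart₁₂.false_of_mem (v := p) (hap ▸ ha) hp
    grind
  -- The clique of neighbours of `x` in `E` meets both `E₁` and `F₁`. If `E₁` avoided `f₁` it would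
  -- lie in `F₁`, but `p ∈ F₂` has a neighbour in `E₁`.
  have hf₁ : f₁ ∈ E₁ := by
    by_contra hf₁
    obtain ⟨r, hr, hxr⟩ := o'.x₁
    obtain ⟨s, hs, hxs⟩ := o.x₁
    have h1 := h.noClaw.eq_or_adj o.apart o.x₃ (o.sub₁ hs) (o'.sub₁ hr) hxs hxr
    have h2 := o.lobe₁.boundary s hs r (hE₁T r hr)
    have h3 := hE₁conn.subset_of_closed (B := F₁) ⟨r, hr, by grind⟩ (by
      intro a ha haF b hb hab
      have := o.lobe₁.boundary a haF b (hE₁T b hb) hab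
      grind)
    obtain ⟨t, ht, hpt⟩ := o'.z₁
    have h4 := o.lobe₂.boundary p hp t (hE₁T t ht) hpt
    have h5 := fun ht' => o.apart₁₂.false_of_mem (v := t) (h3 ht) ht'
    grind
  have hM : Conn G ((S.erase z \ F₂) \ F₁) := by
    refine Lobe.conn_sdiff (e := f₁) h.noClaw (o.lobe₂.conn_sdiff h.noClaw hT) ?_
    have hd := fun v => o.apart₁₂.false_of_mem (v := v)
    obtain ⟨r, hr⟩ := o.lobe₃.nonempty
    have hd1 := fun hh => o.apart₁₃.false_of_mem (v := r) hh hr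
    have hd2 := fun hh => o.apart₂₃.false_of_mem (v := r) hh hr
    have := o.lobe₃.subset hr
    have := o.lobe₁.subset
    have := o.lobe₁.mem
    exact ⟨by grind, o.lobe₁.nonempty, by grind, o.lobe₁.notMem,
      fun a ha b hb hab => o.lobe₁.boundary a ha b (by grind) hab, r, by grind⟩
  -- If `e₁ ∉ F₁` then `F₁ ⊆ E₁`; as `z` sees `F₁` and lies outside `E₁`, it must be `e₁`.
  have he₁ : e₁ ∉ (S.erase z \ F₂) \ F₁ := by
    by_cases he₁ : e₁ ∈ F₁
    · grind
    · obtain ⟨a, ha, hfa⟩ := o.lobe₁.sees hT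
      have h1 := o'.lobe₁.boundary f₁ hf₁ a (hF₁T' a ha) hfa
      have h2 := hF₁conn.subset_of_closed (B := E₁) ⟨a, ha, by grind⟩ (by
        intro a ha haE b hb hab
        have := o'.lobe₁.boundary a haE b (hF₁T' b hb) hab
        grind)
      obtain ⟨g, hg, hzg⟩ := o.z₁
      have h3 := o'.lobe₁.boundary g (h2 hg) z (by grind) hzg.symm
      grind
  have hsub := hM.subset_of_closed (B := E₁) ⟨f₁, by grind [o.lobe₁.mem, o.lobe₁.notMem], hf₁⟩ (by
    intro a ha haE b hb hab
    have := o'.lobe₁.boundary a haE b (by grind) hab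
    grind)
  obtain ⟨r, hr⟩ := o'.lobe₃.nonempty
  have hrE := fun hrE => o'.apart.false_of_mem (v := r) hrE hr
  have hrS := o'.lobe₃.subset hr
  refine o'.apart₁₃.false_of_mem (hsub ?_) hr
  have := fun hr₁ => hrE (o.sub₁ hr₁)
  have := fun hr₂ => hrE (o.sub₂ hr₂)
  grind

lemma exists_good_in_leaf (h : EdgeDeleted G x y S) (hE : Leaf G S E e) :
    ∃ z ∈ E, G.Adj y z ∧ Good G (S.erase z) := by
  have hex : ∃ z ∈ E, G.Adj y z := by
    by_contra! hn
    obtain ⟨r, hr, hrE, hre⟩ := hE.rest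
    have hx : x ∉ E := fun hx => ((h.mem x).1 (hE.subset hx)).1 rfl
    have := h.separate E e x hE.nonempty hE.notMem hx (fun a ha b hab => by
      have h1 := hE.boundary a ha b
      have h2 := h.mem b
      have h3 := hn a ha
      have h4 := G.adj_comm a b
      grind) r
    have := (h.mem r).1 hr
    grind
  obtain ⟨z, hz, hyz⟩ := hex
  by_cases hg : Good G (S.erase z)
  · exact ⟨z, hz, hyz, hg⟩
  · obtain ⟨F₁, f₁, F₂, f₂, F₃, f₃, o⟩ := h.exists_obstruction hE hz hg
    exact h.exists_good_of_obstruction hE hz hyz o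

/-- Two neighbours `z` of `y` can be deleted, each leaving a good set. -/
lemma exists_two_good (h : EdgeDeleted G x y S) (hcard : 2 ≤ S.card) :
    ∃ z₁ z₂, z₁ ≠ z₂ ∧ z₁ ∈ S ∧ z₂ ∈ S ∧ G.Adj y z₁ ∧ G.Adj y z₂ ∧ Good G (S.erase z₁) ∧
      Good G (S.erase z₂) := by
  by_cases hl : ∃ X f, Lobe G S X f
  · obtain ⟨X, f, hX⟩ := hl
    obtain ⟨E₁, e₁, h₁, s₁⟩ := hX.exists_leaf
    obtain ⟨E₂, e₂, h₂, s₂⟩ := hX.compl.exists_leaf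
    obtain ⟨z₁, hz₁, a₁, g₁⟩ := h.exists_good_in_leaf h₁
    obtain ⟨z₂, hz₂, a₂, g₂⟩ := h.exists_good_in_leaf h₂
    refine ⟨z₁, z₂, (hX.apart_compl z₁ (s₁ hz₁) z₂ (s₂ hz₂)).1, h₁.subset hz₁, h₂.subset hz₂,
      a₁, a₂, g₁, g₂⟩
  · push Not at hl
    have key : ∀ z ∈ S, Good G (S.erase z) := fun z hz =>
      Good.erase_of_no_lobe h.noClaw hl (conn_erase_of_no_lobe hz (by
        rw [← Finset.card_pos, Finset.card_erase_of_mem hz]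
        omega) fun X => hl X z)
    have hxS : x ∉ S := fun hx => ((h.mem x).1 hx).1 rfl
    have hyS : y ∉ S := fun hy => ((h.mem y).1 hy).2 rfl
    -- Otherwise `x` and `q` would separate `y` from the rest. Using `q = x` and then `q = z₁` gives
    -- two neighbours.
    have hex : ∀ q, q ≠ y → ∃ z ∈ S, z ≠ q ∧ G.Adj y z := by
      intro q hq
      by_contra! hn
      have := h.separate {y} x q (by simp) (by simpa using h.ne) (by simpa using hq)
        (fun a ha b hab => by
          obtain rfl := Finset.mem_singleton.1 ha
          have h1 := hn b
          have h2 := h.mem b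
          have h3 := hab.ne
          grind)
      have hsub : S ⊆ {q} := fun v hv => by
        have h1 := this v
        have h2 := (h.mem v).1 hv
        grind
      have := Finset.card_le_card hsub
      simp at this
      omega
    obtain ⟨z₁, hz₁, -, a₁⟩ := hex x h.ne
    obtain ⟨z₂, hz₂, hne, a₂⟩ := hex z₁ (fun hh => hyS (hh ▸ hz₁))
    exact ⟨z₁, z₂, hne.symm, hz₁, hz₂, a₁, a₂, key _ hz₁, key _ hz₂⟩

end EdgeDeleted

/-! ### Translation between vertex sets and induced graphs, components and subgraphs. -/

lemma IsClawFree.noClaw {V : Type*} {G : SimpleGraph V} (h : IsClawFree G) : NoClaw G := by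
  intro c a₁ a₂ a₃ h₁ h₂ h₃ n₁₂ n₁₃ n₂₃
  by_contra! hn
  obtain ⟨m₁₂, m₁₃, m₂₃⟩ := hn
  refine h ⟨⟨⟨Sum.elim (fun _ => c) ![a₁, a₂, a₃], ?_⟩, ?_⟩⟩
  · have := h₁.ne
    have := h₂.ne
    have := h₃.ne
    rintro (i | i) (j | j) hij
    · fin_cases i; fin_cases j; rfl
    · fin_cases j <;> simp_all
    · fin_cases i <;> simp_all
    · fin_cases i <;> fin_cases j <;> simp_all
  · have := h₁.symm
    have := h₂.symm
    have := h₃.symm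
    have := fun hh : G.Adj a₂ a₁ => m₁₂ hh.symm
    have := fun hh : G.Adj a₃ a₁ => m₁₃ hh.symm
    have := fun hh : G.Adj a₃ a₂ => m₂₃ hh.symm
    intro u v
    change G.Adj (Sum.elim (fun _ => c) ![a₁, a₂, a₃] u) (Sum.elim (fun _ => c) ![a₁, a₂, a₃] v) ↔ _
    rcases u with i | i <;> rcases v with j | j
    · simp
    · fin_cases j <;> simp_all
    · fin_cases i <;> simp_all
    · fin_cases i <;> fin_cases j <;> simp_all

lemma conn_of_connected {S : Finset V} {W : Set V} (hW : ∀ v, v ∈ W ↔ v ∈ S)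
    (h : (G.induce W).Connected) : Conn G S := by
  obtain ⟨⟨v, hv⟩⟩ := h.nonempty
  refine ⟨⟨v, (hW v).1 hv⟩, fun A hA ⟨a, ha⟩ hcl => Finset.Subset.antisymm hA fun b hb => ?_⟩
  obtain ⟨p⟩ := h.preconnected ⟨a, (hW a).2 (hA ha)⟩ ⟨b, (hW b).2 hb⟩
  have key : ∀ (u v : W), (G.induce W).Walk u v → u.1 ∈ A → v.1 ∈ A := by
    intro u v p
    induction p with
    | nil => exact id
    | cons hadj _ ih => exact fun hu => ih (hcl _ hu _ ((hW _).1 (Subtype.property _)) hadj)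
  exact key _ _ p ha

lemma Conn.connected {S : Finset V} {W : Set V} (hW : ∀ v, v ∈ W ↔ v ∈ S) (h : Conn G S) :
    (G.induce W).Connected := by
  classical
  obtain ⟨⟨v, hv⟩, hcl⟩ := h
  have : Nonempty W := ⟨⟨v, (hW v).2 hv⟩⟩
  refine ⟨fun u w => ?_⟩
  have := hcl (S.filter fun b => ∃ hb : b ∈ W, (G.induce W).Reachable u ⟨b, hb⟩)
    (Finset.filter_subset _ _) ⟨u, Finset.mem_filter.2 ⟨(hW _).1 u.2, u.2, SimpleGraph.Reachable.refl _⟩⟩ (by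
      intro a ha b hb hab
      simp only [Finset.mem_filter] at ha ⊢
      obtain ⟨haS, haW, hr⟩ := ha
      refine ⟨hb, (hW b).2 hb, hr.trans (SimpleGraph.Adj.reachable ?_)⟩
      exact hab)
  have hw := (hW w).1 w.2
  rw [← this] at hw
  exact (Finset.mem_filter.1 hw).2.2

/-- A graph on three vertices with exactly the edges `ab` and `bc` is the 3-vertex path. -/
lemma exists_pathGraph_iso {W : Type*} (K : SimpleGraph W) (a b c : W) (hac : a ≠ c)
    (hall : ∀ w, w = a ∨ w = b ∨ w = c) (hab : K.Adj a b) (hbc : K.Adj b c) (hn : ¬ K.Adj a c) :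
    ∃ e : SimpleGraph.pathGraph 3 ≃g K, e 1 = b := by
  have h1 := hab.ne
  have h2 := hbc.ne
  have hinj : Function.Injective ![a, b, c] := by
    intro i j hij
    fin_cases i <;> fin_cases j <;> simp_all
  have hsurj : Function.Surjective ![a, b, c] := by
    intro w
    rcases hall w with rfl | rfl | rfl
    · exact ⟨0, rfl⟩
    · exact ⟨1, rfl⟩
    · exact ⟨2, rfl⟩
  refine ⟨⟨Equiv.ofBijective _ ⟨hinj, hsurj⟩, ?_⟩, rfl⟩
  have h3 := hab.symm
  have h4 := hbc.symm
  have h5 : ¬ K.Adj c a := fun h => hn h.symm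
  intro i j
  change K.Adj (![a, b, c] i) (![a, b, c] j) ↔ _
  rw [SimpleGraph.pathGraph_adj]
  fin_cases i <;> fin_cases j <;> simp_all

/-- `H` is a disjoint union of 3-vertex paths of `G` covering `S`. -/
def PathUnion (G : SimpleGraph V) (S : Finset V) (H : SimpleGraph V) : Prop :=
  H ≤ G ∧ (∀ a b, H.Adj a b → a ∈ S) ∧ ∀ v ∈ S, ∃ a b c, a ≠ c ∧ H.Adj a b ∧ H.Adj b c ∧
    (v = a ∨ v = b ∨ v = c) ∧ (∀ u, H.Adj a u ↔ u = b) ∧ (∀ u, H.Adj b u ↔ u = a ∨ u = c) ∧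
    ∀ u, H.Adj c u ↔ u = b

/-- The 3-vertex path `a b c`. -/
def triplePath (a b c : V) (hab : a ≠ b) (hbc : b ≠ c) : SimpleGraph V where
  Adj u v := (u = b ∧ (v = a ∨ v = c)) ∨ (v = b ∧ (u = a ∨ u = c))
  symm := ⟨fun u v h => by tauto⟩
  loopless := ⟨fun u h => by grind⟩

/-- Keeping the path system as a graph on all of `V` makes the union step a plain supremum: neither
summand has edges at the vertices of the other part. -/
lemma Fac.exists_pathUnion {S : Finset V} (h : Fac G S) : ∃ H, PathUnion G S H := by
  induction h with
  | triple a b c hac hab hbc =>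
    have h1 := hab.ne
    have h2 := hbc.ne
    have h3 := hab.symm
    have h4 := hbc.symm
    refine ⟨triplePath a b c h1 h2, ?_, ?_, fun v hv => ⟨a, b, c, hac, ?_⟩⟩
    · intro u v huv
      simp only [triplePath] at huv
      grind
    · intro u v huv
      simp only [triplePath] at huv
      grind
    · simp only [triplePath]
      grind
  | union A B hd _ _ ihA ihB =>
    obtain ⟨H, hHG, hHA, hH⟩ := ihA
    obtain ⟨K, hKG, hKB, hK⟩ := ihB
    have hdis := fun v (hv : v ∈ A) => Finset.disjoint_left.1 hd hv
    refine ⟨H ⊔ K, sup_le hHG hKG, ?_, ?_⟩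
    · intro u v huv
      rw [SimpleGraph.sup_adj] at huv
      have := hHA u v
      have := hKB u v
      grind
    · intro v hv
      simp only [SimpleGraph.sup_adj]
      rcases Finset.mem_union.1 hv with hv | hv
      · obtain ⟨a, b, c, hac, hab, hbc, hvabc, ha, hb, hc⟩ := hH v hv
        have haA := hHA _ _ hab
        have hbA := hHA _ _ hbc
        have hcA := hHA _ _ hbc.symm
        have k1 := fun u => hKB a u
        have k2 := fun u => hKB b u
        have k3 := fun u => hKB c u
        exact ⟨a, b, c, hac, Or.inl hab, Or.inl hbc, hvabc, by grind, by grind, by grind⟩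
      · obtain ⟨a, b, c, hac, hab, hbc, hvabc, ha, hb, hc⟩ := hK v hv
        have haA := hKB _ _ hab
        have hbA := hKB _ _ hbc
        have hcA := hKB _ _ hbc.symm
        have k1 := fun u => hHA a u
        have k2 := fun u => hHA b u
        have k3 := fun u => hHA c u
        exact ⟨a, b, c, hac, Or.inr hab, Or.inr hbc, hvabc, by grind, by grind, by grind⟩

lemma Fac.hasLambdaFactor {S : Finset V} (h : Fac G S) {W : Set V} (hW : ∀ v, v ∈ W ↔ v ∈ S) :
    HasLambdaFactor (G.induce W) := by
  obtain ⟨H, hHG, hHS, hH⟩ := h.exists_pathUnion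
  let P : (G.induce W).Subgraph :=
    { verts := Set.univ
      Adj := fun a b => H.Adj a b
      adj_sub := fun {a b} hab => hHG hab
      edge_vert := fun _ => Set.mem_univ _
      symm := ⟨fun _ _ hab => hab.symm⟩ }
  refine ⟨P, fun C => ?_, fun v => Set.mem_univ v⟩
  obtain ⟨v, rfl⟩ := C.exists_rep
  obtain ⟨a, b, c, hac, hab, hbc, hv, ha, hb, hc⟩ := hH v.1.1 ((hW _).1 v.1.2)
  let lift : ∀ u, u ∈ S → P.verts := fun u hu => ⟨⟨u, (hW u).2 hu⟩, Set.mem_univ _⟩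
  have haS := hHS _ _ hab
  have hbS := hHS _ _ hbc
  have hcS := hHS _ _ hbc.symm
  have hadj : ∀ (u w : P.verts), P.coe.Adj u w ↔ H.Adj u.1.1 w.1.1 := fun u w => Iff.rfl
  have hrab : P.coe.Reachable (lift a haS) (lift b hbS) :=
    SimpleGraph.Adj.reachable ((hadj _ _).2 hab)
  have hrbc : P.coe.Reachable (lift b hbS) (lift c hcS) :=
    SimpleGraph.Adj.reachable ((hadj _ _).2 hbc)
  have hclosed : ∀ (u w : P.verts), P.coe.Walk u w → (u.1.1 = a ∨ u.1.1 = b ∨ u.1.1 = c) →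
      (w.1.1 = a ∨ w.1.1 = b ∨ w.1.1 = c) := by
    intro u w p
    induction p with
    | nil => exact id
    | cons huv _ ih =>
      intro hu
      apply ih
      have := (hadj _ _).1 huv
      grind
  -- The neighbourhoods prescribed by `PathUnion` make the triple closed, so it is the whole
  -- component of `v`.
  have hmem : ∀ w : P.verts, P.coe.Reachable w v ↔ (w.1.1 = a ∨ w.1.1 = b ∨ w.1.1 = c) := by
    intro w
    constructor
    · rintro ⟨p⟩
      exact hclosed _ _ p.reverse hv
    · have key : ∀ u : P.verts, (u.1.1 = a ∨ u.1.1 = b ∨ u.1.1 = c) →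
          P.coe.Reachable u (lift b hbS) := by
        rintro u (hu | hu | hu)
        · have : u = lift a haS := Subtype.ext (Subtype.ext hu)
          rw [this]
          exact hrab
        · have : u = lift b hbS := Subtype.ext (Subtype.ext hu)
          rw [this]
        · have : u = lift c hcS := Subtype.ext (Subtype.ext hu)
          rw [this]
          exact hrbc.symm
      exact fun hw => (key w hw).trans (key v hv).symm
  have hsupp : ∀ w : P.verts, w ∈ (P.coe.connectedComponentMk v).supp ↔
      (w.1.1 = a ∨ w.1.1 = b ∨ w.1.1 = c) := fun w => by
    rw [SimpleGraph.ConnectedComponent.mem_supp_iff, SimpleGraph.ConnectedComponent.eq]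
    exact hmem w
  obtain ⟨e, -⟩ := exists_pathGraph_iso (P.coe.connectedComponentMk v).toSimpleGraph
    ⟨lift a haS, (hsupp _).2 (Or.inl rfl)⟩ ⟨lift b hbS, (hsupp _).2 (Or.inr (Or.inl rfl))⟩
    ⟨lift c hcS, (hsupp _).2 (Or.inr (Or.inr rfl))⟩
    (fun h => hac (congrArg (fun w => w.1.1.1) h))
    (by
      rintro ⟨w, hw⟩
      rcases (hsupp w).1 hw with h | h | h
      · exact Or.inl (Subtype.ext (Subtype.ext (Subtype.ext h)))
      · exact Or.inr (Or.inl (Subtype.ext (Subtype.ext (Subtype.ext h))))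
      · exact Or.inr (Or.inr (Subtype.ext (Subtype.ext (Subtype.ext h)))))
    hab hbc (fun h => by
      have h' : H.Adj a c := h
      have := (ha c).1 h'
      exact hbc.ne this.symm)
  exact ⟨e.symm⟩

/-- The 3-vertex path `x y z` as a subgraph. -/
def lambdaSubgraph {V : Type*} {G : SimpleGraph V} (x y z : V) (hxy : G.Adj x y) (hyz : G.Adj y z) :
    G.Subgraph where
  verts := {x, y, z}
  Adj u v := (u = y ∧ (v = x ∨ v = z)) ∨ (v = y ∧ (u = x ∨ u = z))
  adj_sub := by
    rintro u v (⟨rfl, rfl | rfl⟩ | ⟨rfl, rfl | rfl⟩)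
    · exact hxy.symm
    · exact hyz
    · exact hxy
    · exact hyz.symm
  edge_vert := by
    rintro u v (⟨rfl, -⟩ | ⟨-, rfl | rfl⟩) <;> simp
  symm := ⟨fun u v h => by tauto⟩

lemma isLambdaCenteredAt_lambdaSubgraph {V : Type*} {G : SimpleGraph V} {x y z : V}
    (hxy : G.Adj x y) (hyz : G.Adj y z) (hxz : x ≠ z) :
    IsLambdaCenteredAt (lambdaSubgraph x y z hxy hyz) y := by
  have h1 := hxy.ne
  have h2 := hyz.ne
  obtain ⟨e, he⟩ := exists_pathGraph_iso (lambdaSubgraph x y z hxy hyz).coe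
    ⟨x, by simp [lambdaSubgraph]⟩ ⟨y, by simp [lambdaSubgraph]⟩ ⟨z, by simp [lambdaSubgraph]⟩
    (fun h => hxz (congrArg Subtype.val h))
    (by
      rintro ⟨w, hw⟩
      rcases hw with h | h | h
      · exact Or.inl (Subtype.ext h)
      · exact Or.inr (Or.inl (Subtype.ext h))
      · exact Or.inr (Or.inr (Subtype.ext h)))
    (by simp [lambdaSubgraph]) (by simp [lambdaSubgraph])
    (by simp [lambdaSubgraph, h1, h2.symm])
  exact ⟨e, by rw [he]⟩

lemma edgeDeleted [Fintype V] (hconn : IsVertexConnected G 3) (hclaw : IsClawFree G) {x y : V}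
    (hxy : x ≠ y) : EdgeDeleted G x y (Finset.univ \ {x, y}) := by
  have key : ∀ p q : V, Conn G (Finset.univ \ {p, q}) := by
    intro p q
    refine conn_of_connected (fun v => ?_) (hconn.2 {p, q} ?_)
    · simp
    · exact Finset.card_le_two.trans_lt (by norm_num)
  refine ⟨hclaw.noClaw, hxy, by simp, fun E p q hne hp hq hcl v => ?_, key x y⟩
  have := (key p q).2 E (fun a ha => by
    have : a ≠ p := fun h => hp (h ▸ ha)
    have : a ≠ q := fun h => hq (h ▸ ha)
    simp [*]) hne (fun a ha b hb hab => by
      have := hcl a ha b hab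
      simp only [Finset.mem_sdiff, Finset.mem_insert, Finset.mem_singleton] at hb
      tauto)
  rw [this]
  simp only [Finset.mem_sdiff, Finset.mem_univ, Finset.mem_insert, Finset.mem_singleton]
  tauto

end LambdaPacking

/-! ### Assembly of the main theorem. -/

theorem mainTheorem9 {V : Type*} [Finite V] (G : SimpleGraph V)
    (hconn : LambdaPacking.IsVertexConnected G 3)
    (hclaw : LambdaPacking.IsClawFree G)
    (hcard : Nat.card V ≡ 0 [MOD 3])
    (x y : V) (hxy : G.Adj x y) :
    ∃ L₁ L₂ : G.Subgraph, L₁ ≠ L₂ ∧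
      (LambdaPacking.IsLambdaCenteredAt L₁ y ∧ L₁.Adj x y ∧
        (LambdaPacking.minus G L₁).Connected ∧
        LambdaPacking.HasLambdaFactor (LambdaPacking.minus G L₁)) ∧
      (LambdaPacking.IsLambdaCenteredAt L₂ y ∧ L₂.Adj x y ∧
        (LambdaPacking.minus G L₂).Connected ∧
        LambdaPacking.HasLambdaFactor (LambdaPacking.minus G L₂)) := by
  classical
  cases nonempty_fintype V
  have h := LambdaPacking.edgeDeleted hconn hclaw hxy.ne
  have hV : 3 < Fintype.card V := by
    have := hconn.1
    rwa [Nat.card_eq_fintype_card] at this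
  have h3 : Fintype.card V % 3 = 0 := by
    rw [Nat.card_eq_fintype_card] at hcard
    exact hcard
  have hS : (Finset.univ \ {x, y} : Finset V).card = Fintype.card V - 2 := by
    rw [Finset.card_sdiff_of_subset (Finset.subset_univ _), Finset.card_pair hxy.ne,
      Finset.card_univ]
  obtain ⟨z₁, z₂, hne, m₁, m₂, a₁, a₂, g₁, g₂⟩ := h.exists_two_good (by omega)
  have key : ∀ (z : V) (hz : z ∈ (Finset.univ \ {x, y} : Finset V)) (a : G.Adj y z),
      LambdaPacking.Good G ((Finset.univ \ {x, y} : Finset V).erase z) →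
      LambdaPacking.IsLambdaCenteredAt (LambdaPacking.lambdaSubgraph x y z hxy a) y ∧
      (LambdaPacking.lambdaSubgraph x y z hxy a).Adj x y ∧
      (LambdaPacking.minus G (LambdaPacking.lambdaSubgraph x y z hxy a)).Connected ∧
      LambdaPacking.HasLambdaFactor
        (LambdaPacking.minus G (LambdaPacking.lambdaSubgraph x y z hxy a)) := by
    intro z hz a g
    have hxz : x ≠ z := by
      rintro rfl
      simp at hz
    have hW : ∀ v, v ∈ ((LambdaPacking.lambdaSubgraph x y z hxy a).verts)ᶜ ↔
        v ∈ (Finset.univ \ {x, y} : Finset V).erase z := by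
      intro v
      simp only [LambdaPacking.lambdaSubgraph, Set.mem_compl_iff, Set.mem_insert_iff,
        Set.mem_singleton_iff, Finset.mem_erase, Finset.mem_sdiff, Finset.mem_univ,
        Finset.mem_insert, Finset.mem_singleton]
      tauto
    have hc : ((Finset.univ \ {x, y} : Finset V).erase z).card % 3 = 0 := by
      rw [Finset.card_erase_of_mem hz]
      omega
    exact ⟨LambdaPacking.isLambdaCenteredAt_lambdaSubgraph hxy a hxz,
      Or.inr ⟨rfl, Or.inl rfl⟩, g.1.connected hW,
      (g.fac hclaw.noClaw hc).hasLambdaFactor hW⟩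
  refine ⟨_, _, fun heq => hne ?_, key z₁ m₁ a₁ g₁, key z₂ m₂ a₂ g₂⟩
  have hz : z₁ ∈ (LambdaPacking.lambdaSubgraph x y z₁ hxy a₁).verts := by
    simp [LambdaPacking.lambdaSubgraph]
  rw [heq] at hz
  simp only [LambdaPacking.lambdaSubgraph, Set.mem_insert_iff, Set.mem_singleton_iff] at hz
  simp only [Finset.mem_sdiff, Finset.mem_univ, Finset.mem_insert, Finset.mem_singleton] at m₁
  tauto
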